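/- **Setting.** Let $1\le k<n$ and $q\ge 1$ be integers, $X\in\mathbb{R}^{n\times k}$ with $\operatorname{rank}X=k$, $R\in\mathbb{R}^{q\times k}$ with $\operatorname{rank}R=q$, and $r\in\mathbb{R}^q$. Put $\mathfrak{M}_0=\{X\beta:\beta\in\mathbb{R}^k,\ R\beta=r\}$ and $\mathfrak{M}_0^{lin}=\{X\beta:\beta\in\mathbb{R}^k,\ R\beta=0\}$. A normalized spectral density is an even, integrable function $f:[-\pi,\pi]\to[0,\infty)$ with $\int_{-\pi}^{\pi}f(\nu)\,d\nu=1$. For such $f$ let $\Sigma(f)=\big[\int_{-\pi}^{\pi}e^{-\iota(j-l)\nu}f(\nu)\,d\nu\big]_{j,l=1}^n$. Let $P_{\mu,A}$ denote the normal distribution on $\mathbb{R}^n$ with mean $\mu$ and covariance matrix $A$. Let $\mathfrak{F}$ be a nonempty set of normalized spectral densities. **Test statistic.** Let $N\subseteq\mathbb{R}^n$ be a closed Lebesgue-null set, and let $\check\beta:\mathbb{R}^n\setminus N\to\mathbb{R}^k$ and $\check\Omega:\mathbb{R}^n\setminus N\to\mathbb{R}^{q\times q}$ be continuous, with $\check\Omega(y)$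 symmetric for every $y\in\mathbb{R}^n\setminus N$. Assume that for every $y\in\mathbb{R}^n\setminus N$, every real $\delta\neq0$ and every $\eta\in\mathbb{R}^k$ we have $\delta y+X\eta\in\mathbb{R}^n\setminus N$, $\check\beta(\delta y+X\eta)=\delta\check\beta(y)+\eta$ and $\check\Omega(\delta y+X\eta)=\delta^2\check\Omega(y)$. Assume also that $\check\Omega(y)$ is nonsingular for Lebesgue-almost every $y\in\mathbb{R}^n\setminus N$. Put $N^*=N\cup\{y\in\mathbb{R}^n\setminus N:\det\check\Omega(y)=0\}$ and let $$T(y)=(R\check\beta(y)-r)'\,\check\Omega(y)^{-1}(R\check\beta(y)-r)\ \text{ for } y\notin N^*,\qquad T(y)=0\ \text{ for } y\in N^*.$$ **Notation.** For $\omega\in[0,\pi]$ and an integer $s\ge0$ let $E_{n,s}(\omega)$ be the $n\times2$ matrix with $j$-th row $(j^s\cos(j\omega),\,j^s\sin(j\omega))$. Let $\operatorname{span}$ of a matrix denote its column space. Put $\mathcal{L}=\mathfrak{M}_0^{lin}$ and $\rho(\omega)=\min\{s\ge0:\operatorname{span}(E_{n,s}(\omega))\not\subseteq\mathcal{L}\}$.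 Let $\kappa(\omega)=1$ and $\Delta_\omega(z)=1-\cos(\omega)z$ if $\omega\in\{0,\pi\}$; let $\kappa(\omega)=2$ and $\Delta_\omega(z)=1-2\cos(\omega)z+z^2$ if $\omega\in(0,\pi)$. The set $\{\omega\in[0,\pi]:\rho(\omega)>0\}$ is finite; put $\bar\kappa=\sum_{\omega:\rho(\omega)>0}\kappa(\omega)\rho(\omega)$ and $\Delta(z)=\prod_{\omega:\rho(\omega)>0}\Delta_\omega(z)^{\rho(\omega)}$. Let $\mathbb{S}$ be the collection of all sets $\operatorname{supp}(\mathsf m)\cap[0,\pi]$, where $\mathsf m$ is a finite Borel measure on $[-\pi,\pi]$, symmetric about $0$ and with finite support, such that * $\mathsf m$ is the weak limit of measures with Lebesgue densities $g_j(\nu)=|\Delta(e^{\iota\nu})|^2f_j(\nu)\big/\int_{-\pi}^{\pi}|\Delta(e^{\iota x})|^2f_j(x)\,dx$ for some sequence $f_j\in\mathfrak{F}$, and * $\sum_{\gamma\in\operatorname{supp}(\mathsf m)\cap[0,\pi]}\kappa(\gamma)<n-\bar\kappa$. For $\Gamma=\{\gamma_1,\dots,\gamma_p\}\in\mathbb{S}$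 put $\mathcal{T}_\Gamma=\operatorname{span}\big(E_{n,\rho(\gamma_1)}(\gamma_1),\dots,E_{n,\rho(\gamma_p)}(\gamma_p)\big)$. Let $\lambda_{\mathcal{T}}$ be Lebesgue measure on the linear subspace $\mathcal{T}$, viewed as a measure on $\mathbb{R}^n$. **Theorem.** 1. Suppose that $\lambda_{\mathcal{T}_\Gamma}(N^*)=0$ for every $\Gamma\in\mathbb{S}$. Then for every $0<\alpha<1$ there exists a real number $C(\alpha)$ such that $$\sup_{\mu_0\in\mathfrak{M}_0}\ \sup_{0<\sigma^2<\infty}\ \sup_{f\in\mathfrak{F}}P_{\mu_0,\sigma^2\Sigma(f)}\big(T\ge C(\alpha)\big)\le\alpha .$$ 2. Suppose that $N^*$ is a finite or countable union of affine subspaces. Then, for every $\Gamma\in\mathbb{S}$, the condition $\lambda_{\mathcal{T}_\Gamma}(N^*)=0$ is equivalent to $\mathcal{T}_\Gamma\not\subseteq N^*$. Furthermore, a sufficient condition for $\mathcal{T}_\Gamma\not\subseteq N^*$ to hold for every $\Gamma\in\mathbb{S}$ is that $\operatorname{span}(E_{n,\rho(\gamma)}(\gamma))\not\subseteq N^*$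 for every $\gamma\in\bigcup\mathbb{S}$. An even stricter sufficient condition is that $\operatorname{span}(E_{n,\rho(\gamma)}(\gamma))\not\subseteq N^*$ for every $\gamma\in[0,\pi]$. -/

import Mathlib

open MeasureTheory ProbabilityTheory Filter Topology Set
open scoped Matrix ENNReal Real

noncomputable section

namespace SizeControl

/-! ### The linear model and the null hypothesis -/

section Model

variable {n k q : ℕ}

/-- The mean vector `X β`, as a point of Euclidean `n`-space. -/
def meanVec (X : Matrix (Fin n) (Fin k) ℝ) (β : Fin k → ℝ) : EuclideanSpace ℝ (Fin n) :=
  WithLp.toLp 2 (X *ᵥ β)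

/-- The affine space `𝔐₀ = {X β : R β = r}` of mean vectors that satisfy the null hypothesis. -/
def nullMeans (X : Matrix (Fin n) (Fin k) ℝ) (R : Matrix (Fin q) (Fin k) ℝ) (r : Fin q → ℝ) :
    Set (EuclideanSpace ℝ (Fin n)) :=
  {μ | ∃ β : Fin k → ℝ, μ = meanVec X β ∧ R *ᵥ β = r}

/-- The linear space `𝔐₀ˡⁱⁿ = {X β : R β = 0}` parallel to `𝔐₀`. -/
def nullMeansLin (X : Matrix (Fin n) (Fin k) ℝ) (R : Matrix (Fin q) (Fin k) ℝ) :
    Submodule ℝ (EuclideanSpace ℝ (Fin n)) where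
  carrier := {μ | ∃ β : Fin k → ℝ, μ = meanVec X β ∧ R *ᵥ β = 0}
  add_mem' := by
    rintro _ _ ⟨b, rfl, hb⟩ ⟨c, rfl, hc⟩
    exact ⟨b + c, by simp [meanVec, Matrix.mulVec_add], by simp [Matrix.mulVec_add, hb, hc]⟩
  zero_mem' := ⟨0, by simp [meanVec], by simp⟩
  smul_mem' := by
    rintro a _ ⟨b, rfl, hb⟩
    exact ⟨a • b, by simp [meanVec, Matrix.mulVec_smul], by simp [Matrix.mulVec_smul, hb]⟩

/-- `𝔐₀ˡⁱⁿ = 𝔐₀ - μ₀` for every `μ₀ ∈ 𝔐₀`. -/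
theorem sub_mem_nullMeansLin_iff (X : Matrix (Fin n) (Fin k) ℝ) (R : Matrix (Fin q) (Fin k) ℝ)
    (r : Fin q → ℝ) {μ₀ : EuclideanSpace ℝ (Fin n)} (h₀ : μ₀ ∈ nullMeans X R r)
    (μ : EuclideanSpace ℝ (Fin n)) :
    μ - μ₀ ∈ nullMeansLin X R ↔ μ ∈ nullMeans X R r := by
  obtain ⟨b, rfl, hb⟩ := h₀
  constructor
  · rintro ⟨c, hc, hc0⟩
    refine ⟨c + b, ?_, by simp [Matrix.mulVec_add, hb, hc0]⟩
    rw [sub_eq_iff_eq_add] at hc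
    simp [hc, meanVec, Matrix.mulVec_add]
  · rintro ⟨c, rfl, hc⟩
    exact ⟨c - b, by simp [meanVec, Matrix.mulVec_sub], by simp [Matrix.mulVec_sub, hb, hc]⟩

end Model

/-! ### Spectral densities and rejection probabilities -/

/-- `f`, restricted to `[-π, π]`, is a normalized spectral density: nonnegative, even, integrable,
with integral one. Only the values of `f` on `[-π, π]` matter here and below. -/
structure IsNormalizedSpectralDensity (f : ℝ → ℝ) : Prop where
  nonneg : ∀ ν ∈ Icc (-π) π, 0 ≤ f ν
  even : ∀ ν ∈ Icc (-π) π, f (-ν) = f ν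
  integrable : IntegrableOn f (Icc (-π) π)
  integral_eq_one : ∫ ν in Icc (-π) π, f ν = 1

/-- The covariance matrix `Σ(f)` with entries `∫_{-π}^{π} exp(-i (j - l) ν) f(ν) dν`. These integrals
are real since `f` is even, so that taking the real part only changes the type. -/
def covMatrix (n : ℕ) (f : ℝ → ℝ) : Matrix (Fin n) (Fin n) ℝ :=
  Matrix.of fun j l =>
    (∫ ν in Icc (-π) π, Complex.exp (-(Complex.I * ((j : ℂ) - (l : ℂ)) * ν)) * (f ν : ℂ)).re

/-- The supremum over `μ₀ ∈ 𝔐₀`, `0 < σ² < ∞` and `f ∈ 𝔉` of the probability of the rejection region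
`W` under the normal distribution with mean `μ₀` and covariance matrix `σ² Σ(f)`. -/
def testSize {n k q : ℕ} (X : Matrix (Fin n) (Fin k) ℝ) (R : Matrix (Fin q) (Fin k) ℝ)
    (r : Fin q → ℝ) (F : Set (ℝ → ℝ)) (W : Set (EuclideanSpace ℝ (Fin n))) : ℝ≥0∞ :=
  ⨆ μ₀ ∈ nullMeans X R r, ⨆ σsq ∈ Ioi (0 : ℝ), ⨆ f ∈ F,
    multivariateGaussian μ₀ (σsq • covMatrix n f) W

/-! ### Nonsphericity-corrected F-type test statistics -/

section TestStatistic

variable {n k q : ℕ}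

/-- The standing assumption on the estimators `β̌` and `Ω̌` that enter a nonsphericity-corrected
F-type test statistic. Both are functions on the complement of `N`; their values on `N` are
irrelevant. -/
structure EstimatorAssumption (X : Matrix (Fin n) (Fin k) ℝ) (N : Set (EuclideanSpace ℝ (Fin n)))
    (βc : EuclideanSpace ℝ (Fin n) → Fin k → ℝ)
    (Ωc : EuclideanSpace ℝ (Fin n) → Matrix (Fin q) (Fin q) ℝ) : Prop where
  isClosed : IsClosed N
  null : volume N = 0
  continuousOn_beta : ContinuousOn βc Nᶜ
  continuousOn_omega : ContinuousOn Ωc Nᶜ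
  symm : ∀ y ∈ Nᶜ, (Ωc y).IsSymm
  invariant : ∀ y ∈ Nᶜ, ∀ δ : ℝ, δ ≠ 0 → ∀ η : Fin k → ℝ, δ • y + meanVec X η ∈ Nᶜ
  beta_equivariant : ∀ y ∈ Nᶜ, ∀ δ : ℝ, δ ≠ 0 → ∀ η : Fin k → ℝ,
    βc (δ • y + meanVec X η) = δ • βc y + η
  omega_equivariant : ∀ y ∈ Nᶜ, ∀ δ : ℝ, δ ≠ 0 → ∀ η : Fin k → ℝ,
    Ωc (δ • y + meanVec X η) = δ ^ 2 • Ωc y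
  ae_nonsingular : ∀ᵐ y, y ∈ Nᶜ → (Ωc y).det ≠ 0

/-- `N* = N ∪ {y ∉ N : det Ω̌(y) = 0}`. -/
def nStar (N : Set (EuclideanSpace ℝ (Fin n)))
    (Ωc : EuclideanSpace ℝ (Fin n) → Matrix (Fin q) (Fin q) ℝ) :
    Set (EuclideanSpace ℝ (Fin n)) :=
  N ∪ {y | y ∈ Nᶜ ∧ (Ωc y).det = 0}

open Classical in
/-- The test statistic `T(y) = (R β̌(y) - r)' Ω̌(y)⁻¹ (R β̌(y) - r)` off `N*`, and `T(y) = 0` on `N*`. -/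
def fTypeStat (R : Matrix (Fin q) (Fin k) ℝ) (r : Fin q → ℝ) (N : Set (EuclideanSpace ℝ (Fin n)))
    (βc : EuclideanSpace ℝ (Fin n) → Fin k → ℝ)
    (Ωc : EuclideanSpace ℝ (Fin n) → Matrix (Fin q) (Fin q) ℝ)
    (y : EuclideanSpace ℝ (Fin n)) : ℝ :=
  if y ∈ nStar N Ωc then 0
  else (R *ᵥ βc y - r) ⬝ᵥ ((Ωc y)⁻¹ *ᵥ (R *ᵥ βc y - r))

end TestStatistic

/-! ### The spaces spanned by `E_{n,s}(ω)` -/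

/-- The `n × 2` matrix `E_{n,s}(ω)` with `j`-th row `(jˢ cos(jω), jˢ sin(jω))`, `j = 1, …, n`. -/
def trigMatrix (n s : ℕ) (ω : ℝ) : Matrix (Fin n) (Fin 2) ℝ :=
  Matrix.of fun j => ![((j : ℝ) + 1) ^ s * Real.cos (((j : ℝ) + 1) * ω),
    ((j : ℝ) + 1) ^ s * Real.sin (((j : ℝ) + 1) * ω)]

/-- The column space of `E_{n,s}(ω)`. -/
def trigSpan (n s : ℕ) (ω : ℝ) : Submodule ℝ (EuclideanSpace ℝ (Fin n)) :=
  Submodule.span ℝ (range fun c : Fin 2 => WithLp.toLp 2 ((trigMatrix n s ω).col c))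

/-- `ρ(ω, 𝓛)`, the least `s ≥ 0` with `span E_{n,s}(ω) ⊈ 𝓛`. Such an `s` exists when `dim 𝓛 < n`. -/
def rho {n : ℕ} (ω : ℝ) (L : Submodule ℝ (EuclideanSpace ℝ (Fin n))) : ℕ :=
  sInf {s : ℕ | ¬ trigSpan n s ω ≤ L}

/-- The column space of `(E_{n,ρ(γ₁,𝓛)}(γ₁), …, E_{n,ρ(γₚ,𝓛)}(γₚ))`, where `Γ = {γ₁, …, γₚ}`. -/
def jointSpan {n : ℕ} (L : Submodule ℝ (EuclideanSpace ℝ (Fin n))) (Γ : Set ℝ) :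
    Submodule ℝ (EuclideanSpace ℝ (Fin n)) :=
  ⨆ γ ∈ Γ, trigSpan n (rho γ L) γ

/-- Lebesgue measure on a linear subspace, viewed as a measure on the ambient space. It is a point
mass at `0` for the zero subspace. -/
def lebesgueOn {n : ℕ} (S : Submodule ℝ (EuclideanSpace ℝ (Fin n))) :
    Measure (EuclideanSpace ℝ (Fin n)) :=
  Measure.map (fun x : S => (x : EuclideanSpace ℝ (Fin n))) (stdOrthonormalBasis ℝ S).toBasis.addHaar

/-! ### The collection `𝕊(𝔉, 𝓛)` -/

open Classical in
/-- `κ(ω, d) = d` if `ω ∈ {0, π}`, and `κ(ω, d) = 2 d` otherwise. -/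
def kappa (ω : ℝ) (d : ℕ) : ℕ := if ω = 0 ∨ ω = π then d else 2 * d

/-- The set `{ω ∈ [0, π] : ρ(ω, 𝓛) > 0}`, which is finite when `dim 𝓛 < n`; its elements are the
coordinates of `ω(𝓛)`, and the coordinates of `d(𝓛)` are the values `ρ(ω, 𝓛)`. -/
def exceptionalFreqs {n : ℕ} (L : Submodule ℝ (EuclideanSpace ℝ (Fin n))) : Set ℝ :=
  {ω | ω ∈ Icc 0 π ∧ 0 < rho ω L}

/-- `κ(ω(𝓛), d(𝓛))`, the sum of the `κ(ω, ρ(ω, 𝓛))` over the exceptional frequencies. -/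
def kappaOf {n : ℕ} (L : Submodule ℝ (EuclideanSpace ℝ (Fin n))) : ℕ :=
  ∑ᶠ ω ∈ exceptionalFreqs L, kappa ω (rho ω L)

open Classical in
open Polynomial in
/-- `Δ_ω(z) = 1 - cos(ω) z` if `ω ∈ {0, π}`, and `Δ_ω(z) = 1 - 2 cos(ω) z + z²` otherwise. -/
def diffPoly (ω : ℝ) : Polynomial ℝ :=
  if ω = 0 ∨ ω = π then 1 - C (Real.cos ω) * X else 1 - C (2 * Real.cos ω) * X + X ^ 2

/-- `Δ_{ω(𝓛), d(𝓛)}`, the product of the `Δ_ω ^ ρ(ω, 𝓛)` over the exceptional frequencies. -/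
def diffPolyOf {n : ℕ} (L : Submodule ℝ (EuclideanSpace ℝ (Fin n))) : Polynomial ℝ :=
  ∏ᶠ ω ∈ exceptionalFreqs L, diffPoly ω ^ rho ω L

/-- `|Δ_{ω(𝓛), d(𝓛)}(exp(iν))|² f(ν)`. -/
def filteredDensity {n : ℕ} (L : Submodule ℝ (EuclideanSpace ℝ (Fin n))) (f : ℝ → ℝ) (ν : ℝ) : ℝ :=
  ‖Polynomial.aeval (Complex.exp (Complex.I * ν)) (diffPolyOf L)‖ ^ 2 * f ν

/-- The previous function, normalized to have integral one over `[-π, π]`. -/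
def normalizedFilteredDensity {n : ℕ} (L : Submodule ℝ (EuclideanSpace ℝ (Fin n))) (f : ℝ → ℝ)
    (ν : ℝ) : ℝ :=
  filteredDensity L f ν / ∫ x in Icc (-π) π, filteredDensity L f x

/-- The measure on `[-π, π]` with Lebesgue density `g`. Borel measures on `[-π, π]` are identified
with the Borel measures on `ℝ` that vanish outside `[-π, π]`. -/
def spectralMeasure (g : ℝ → ℝ) : Measure ℝ :=
  (volume.restrict (Icc (-π) π)).withDensity fun ν => ENNReal.ofReal (g ν)

/-- `m ∈ 𝕄(𝔉, 𝓛)`: a finite symmetric Borel measure on `[-π, π]` with finite support that is a weak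
limit of measures with densities `g_j` (normalized filtered densities of members of `𝔉`) and whose
support satisfies the counting condition. -/
structure IsLimitMeasure {n : ℕ} (F : Set (ℝ → ℝ)) (L : Submodule ℝ (EuclideanSpace ℝ (Fin n)))
    (m : Measure ℝ) : Prop where
  finite : IsFiniteMeasure m
  concentrated : m (Icc (-π) π)ᶜ = 0
  symmetric : ∀ A : Set ℝ, MeasurableSet A → m {ν | -ν ∈ A} = m A
  finite_support : m.support.Finite
  weak_limit : ∃ f : ℕ → ℝ → ℝ, (∀ j, f j ∈ F) ∧
    ∀ φ : BoundedContinuousFunction ℝ ℝ,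
      Tendsto (fun j => ∫ ν, φ ν ∂spectralMeasure (normalizedFilteredDensity L (f j))) atTop
        (𝓝 (∫ ν, φ ν ∂m))
  count : (∑ᶠ γ ∈ m.support ∩ Icc 0 π, kappa γ 1) + kappaOf L < n

/-- `𝕊(𝔉, 𝓛) = {supp(m) ∩ [0, π] : m ∈ 𝕄(𝔉, 𝓛)}`. -/
def limitSupports {n : ℕ} (F : Set (ℝ → ℝ)) (L : Submodule ℝ (EuclideanSpace ℝ (Fin n))) :
    Set (Set ℝ) :=
  {Γ | ∃ m : Measure ℝ, IsLimitMeasure F L m ∧ Γ = m.support ∩ Icc 0 π}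

/-- A set is a finite or countable union of affine subspaces. -/
def IsCountableUnionOfAffine {n : ℕ} (A : Set (EuclideanSpace ℝ (Fin n))) : Prop :=
  ∃ 𝒜 : Set (AffineSubspace ℝ (EuclideanSpace ℝ (Fin n))),
    𝒜.Countable ∧ A = ⋃ P ∈ 𝒜, (P : Set (EuclideanSpace ℝ (Fin n)))

end SizeControl

end

open SizeControl

open SizeControl

/-! Write `L` for `nullMeansLin X R`, `Δ` for `diffPolyOf L`, `p_v` for the polynomial with
coefficient vector `v`. If no critical value works for `α`, then for each `j` some null distribution
gives `T ≥ j` probability above `α`. `T` is invariant under rescaling about a null mean and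
translation along `L`, so this probability is that of `T₀(B_j x) ≥ j`. Here `x` is standard normal,
`T₀` is the statistic with `r = 0`, and `B_j` is the root of the covariance matrix, projected onto
`Lᗮ` and rescaled.

The scale is chosen through polynomials. Orthogonality of `v` to the spans of `E_{n,s}(ω)`, `s < m`,
means that `p_v` vanishes to order `m` at `e^{±iω}`. Hence `v ∈ Lᗮ` gives `p_v = Δ w`, and `v'Σ(f)v
= ∫ |p_v|² f`, divided by `∫ |Δ|² f`, is the integral of `|w|²` against the normalized filtered
density, a probability measure on `[-π, π]`. Along a subsequence these measures converge weakly to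
some `m`, the `B_j` converge to some `A`, and `‖A* v‖² = ∫ |w|² dm`.

So `A* v = 0` exactly if `w` vanishes on the support of `m`, that is, if `v` is orthogonal to every
span of `E_{n,ρ(γ)}(γ)` with `γ` in `supp m ∩ [0, π]` (`eval_quotient_eq_zero_iff`). The range of
`A` modulo `L` is therefore that of `𝒯_Γ` (`range_sup_eq_jointSpan_sup`). If the counting condition
or finiteness of the support fails, `deg p_v < n` leaves `w` too few zeros and `A` is onto modulo
`L` (`range_sup_eq_top`). As `N*` is invariant under `L`, almost surely `A x ∉ N*` in either case
(`ae_notMem_iff_of_range_sup_eq`). By continuity `T₀(B_j x)` converges to a finite limit, which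
contradicts the levels tending to infinity.

The second part holds because an affine subspace is null in a linear space it does not contain, and
because every `Γ` is nonempty, `m` having mass one. -/

namespace SizeControl

/-! ### Coefficient polynomials -/

section CoefficientPolynomials

open Polynomial in
/-- The Euler operator `p ↦ X p'`. -/
noncomputable def eulerOp (p : Polynomial ℂ) : Polynomial ℂ := X * derivative p

open Polynomial in
/-- Over `ℂ`, divisibility by `(X - z) ^ m`, `z ≠ 0`, is tested by iterates of the Euler operator. -/
theorem X_sub_C_pow_dvd_iff_eulerOp {z : ℂ} (hz : z ≠ 0) (m : ℕ) (p : Polynomial ℂ) :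
    (X - C z) ^ m ∣ p ↔ ∀ s < m, (eulerOp^[s] p).eval z = 0 := by
  induction m generalizing p with
  | zero => simp
  | succ m ih =>
    -- One differentiation lowers the multiplicity of a root by exactly one (characteristic zero),
    -- and the factor `X` is harmless since it is coprime to `X - z`.
    have key : (X - C z) ^ (m + 1) ∣ p ↔ p.eval z = 0 ∧ (X - C z) ^ m ∣ eulerOp p := by
      have hcop : IsCoprime ((X - C z) ^ m) (X : Polynomial ℂ) := by
        refine IsCoprime.pow_left ?_
        simpa using isCoprime_X_sub_C_of_isUnit_sub (R := ℂ) (a := z) (b := 0) (by simpa using hz)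
      have h1 : (X - C z) ^ m ∣ eulerOp p ↔ (X - C z) ^ m ∣ derivative p :=
        ⟨fun h => hcop.dvd_of_dvd_mul_left h, fun h => h.mul_left _⟩
      rw [h1]
      rcases eq_or_ne p 0 with rfl | hp
      · simp
      constructor
      · intro h
        refine ⟨?_, ?_⟩
        · exact dvd_iff_isRoot.1 ((dvd_pow_self _ (Nat.succ_ne_zero m)).trans h)
        · obtain ⟨q, rfl⟩ := h
          rw [derivative_mul, derivative_pow]
          refine dvd_add ?_ ?_
          · refine Dvd.dvd.mul_right ?_ _
            refine Dvd.dvd.mul_right ?_ _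
            exact Dvd.dvd.mul_left (by simp) _
          · exact ((pow_dvd_pow _ (Nat.le_succ m))).mul_right _
      · rintro ⟨h0, hd⟩
        have hroot : p.IsRoot z := h0
        rw [← le_rootMultiplicity_iff hp]
        have hpos := (rootMultiplicity_pos hp).2 hroot
        have hd0 : derivative p ≠ 0 := by
          intro h
          have := derivative_eq_zero.1 h
          rw [eq_C_of_natDegree_eq_zero this] at hroot hp
          simp at hroot
          simp [hroot] at hp
        have := (le_rootMultiplicity_iff hd0).2 hd
        rw [derivative_rootMultiplicity_of_root hroot] at this
        omega
    rw [key, ih]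
    constructor
    · rintro ⟨h0, h⟩ s hs
      cases s with
      | zero => simpa using h0
      | succ s => simpa using h s (by omega)
    · intro h
      exact ⟨by simpa using h 0 (by omega), fun s hs => by simpa using h (s + 1) (by omega)⟩

variable {n : ℕ}

open Polynomial in
/-- The polynomial with coefficient vector `v`. -/
noncomputable def coeffPoly (v : EuclideanSpace ℝ (Fin n)) : Polynomial ℂ :=
  ∑ j : Fin n, C (v j : ℂ) * X ^ (j : ℕ)

/-- The inner product of `v` with the vector of entries `(j + 1) ^ s * z ^ (j + 1)`. -/
def trigSum (v : EuclideanSpace ℝ (Fin n)) (s : ℕ) (z : ℂ) : ℂ :=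
  ∑ j : Fin n, (v j : ℂ) * ((j : ℂ) + 1) ^ s * z ^ ((j : ℕ) + 1)

-- Each monomial `X ^ (j + 1)` is an eigenvector of the Euler operator with eigenvalue `j + 1`. The
-- extra factor `X` matches the zero-based index of `Fin n` to the rows `1, …, n` of `E_{n,s}(ω)`.
open Polynomial in
theorem eulerOp_iterate_X_mul_coeffPoly (v : EuclideanSpace ℝ (Fin n)) (s : ℕ) :
    eulerOp^[s] (X * coeffPoly v) =
      ∑ j : Fin n, C ((v j : ℂ) * ((j : ℂ) + 1) ^ s) * X ^ ((j : ℕ) + 1) := by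
  induction s with
  | zero =>
    simp only [Function.iterate_zero, id, coeffPoly, Finset.mul_sum, pow_zero, mul_one]
    exact Finset.sum_congr rfl fun j _ => by ring
  | succ s ih =>
    rw [Function.iterate_succ_apply', ih, eulerOp, derivative_sum, Finset.mul_sum]
    refine Finset.sum_congr rfl fun j _ => ?_
    rw [derivative_C_mul, derivative_X_pow, Nat.add_sub_cancel]
    simp only [map_mul, map_pow, map_add, map_one, Nat.cast_add, Nat.cast_one, map_natCast]
    ring

open Polynomial in
theorem X_sub_C_pow_dvd_coeffPoly_iff {z : ℂ} (hz : z ≠ 0) (m : ℕ)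
    (v : EuclideanSpace ℝ (Fin n)) :
    (X - C z) ^ m ∣ coeffPoly v ↔ ∀ s < m, trigSum v s z = 0 := by
  have hcop : IsCoprime ((X - C z) ^ m) (X : Polynomial ℂ) := by
    refine IsCoprime.pow_left ?_
    simpa using isCoprime_X_sub_C_of_isUnit_sub (R := ℂ) (a := z) (b := 0) (by simpa using hz)
  have h1 : (X - C z) ^ m ∣ coeffPoly v ↔ (X - C z) ^ m ∣ X * coeffPoly v :=
    ⟨fun h => h.mul_left _, fun h => hcop.dvd_of_dvd_mul_left h⟩
  rw [h1, X_sub_C_pow_dvd_iff_eulerOp hz]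
  refine forall₂_congr fun s _ => ?_
  rw [eulerOp_iterate_X_mul_coeffPoly]
  simp [trigSum, eval_finsetSum]

/-! ### Zeros of the differencing factors and orthogonality to trigonometric spans -/

/-- The complex zeros of `diffPoly ω`. -/
noncomputable def diffRoots (ω : ℝ) : Finset ℂ := {Complex.exp (Complex.I * ω), Complex.exp (-(Complex.I * ω))}

theorem norm_of_mem_diffRoots {ω : ℝ} {z : ℂ} (hz : z ∈ diffRoots ω) : ‖z‖ = 1 := by
  simp only [diffRoots, Finset.mem_insert, Finset.mem_singleton] at hz
  rcases hz with rfl | rfl <;> simp [Complex.norm_exp]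

theorem ne_zero_of_mem_diffRoots {ω : ℝ} {z : ℂ} (hz : z ∈ diffRoots ω) : z ≠ 0 := by
  rw [← norm_pos_iff, norm_of_mem_diffRoots hz]; exact one_pos

theorem exp_mem_diffRoots (ω : ℝ) : Complex.exp (Complex.I * ω) ∈ diffRoots ω := by
  simp [diffRoots]

theorem re_of_mem_diffRoots {ω : ℝ} {z : ℂ} (hz : z ∈ diffRoots ω) : z.re = Real.cos ω := by
  simp only [diffRoots, Finset.mem_insert, Finset.mem_singleton] at hz
  rcases hz with rfl | rfl <;> simp [Complex.exp_re]

/-- Both zeros have real part `cos ω`, and the cosine is injective on `[0, π]`. -/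
theorem disjoint_diffRoots {ω ω' : ℝ} (h : ω ∈ Icc 0 π) (h' : ω' ∈ Icc 0 π) {z : ℂ}
    (hz : z ∈ diffRoots ω) (hz' : z ∈ diffRoots ω') : ω = ω' :=
  Real.injOn_cos h h' (by rw [← re_of_mem_diffRoots hz, re_of_mem_diffRoots hz'])

theorem sin_ne_zero_of_interior {ω : ℝ} (h : ω ∈ Icc 0 π) (h0 : ¬ (ω = 0 ∨ ω = π)) :
    Real.sin ω ≠ 0 := by
  push Not at h0
  exact (Real.sin_pos_of_pos_of_lt_pi (lt_of_le_of_ne h.1 h0.1.symm)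
    (lt_of_le_of_ne h.2 h0.2)).ne'

theorem exp_ne_exp_neg {ω : ℝ} (h : ω ∈ Icc 0 π) (h0 : ¬ (ω = 0 ∨ ω = π)) :
    Complex.exp (Complex.I * ω) ≠ Complex.exp (-(Complex.I * ω)) := by
  intro he
  have := congrArg Complex.im he
  simp [Complex.exp_im] at this
  exact sin_ne_zero_of_interior h h0 (by linarith)

theorem exp_eq_cos_of_boundary {ω : ℝ} (h0 : ω = 0 ∨ ω = π) :
    Complex.exp (Complex.I * ω) = (Real.cos ω : ℂ) ∧
      Complex.exp (-(Complex.I * ω)) = (Real.cos ω : ℂ) := by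
  rcases h0 with rfl | rfl
  · simp
  · constructor
    · rw [mul_comm, Complex.exp_pi_mul_I]; simp
    · rw [Complex.exp_neg, mul_comm, Complex.exp_pi_mul_I]; simp

theorem card_diffRoots {ω : ℝ} (h : ω ∈ Icc 0 π) : (diffRoots ω).card = kappa ω 1 := by
  unfold kappa
  split_ifs with h0
  · obtain ⟨h1, h2⟩ := exp_eq_cos_of_boundary h0
    rw [diffRoots, h1, h2]; simp
  · rw [diffRoots, Finset.card_pair (exp_ne_exp_neg h h0)]

theorem kappa_eq (ω : ℝ) (d : ℕ) : kappa ω d = d * kappa ω 1 := by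
  unfold kappa; split_ifs <;> ring

open Polynomial in
theorem diffPoly_map {ω : ℝ} (h : ω ∈ Icc 0 π) :
    ∃ c : ℂ, c ≠ 0 ∧
      (diffPoly ω).map (algebraMap ℝ ℂ) = C c * ∏ z ∈ diffRoots ω, (X - C z) := by
  unfold diffPoly
  split_ifs with h0
  · obtain ⟨h1, h2⟩ := exp_eq_cos_of_boundary h0
    have hsq : (Real.cos ω : ℂ) * (Real.cos ω : ℂ) = 1 := by
      rcases h0 with rfl | rfl <;> simp
    refine ⟨-(Real.cos ω : ℂ), ?_, ?_⟩
    · intro hc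
      rw [neg_eq_zero] at hc
      simp [hc] at hsq
    · rw [diffRoots, h1, h2]
      simp only [Finset.pair_eq_singleton, Finset.prod_singleton, Polynomial.map_sub,
        Polynomial.map_one, Polynomial.map_mul, map_C, map_X, Complex.coe_algebraMap]
      have : (1 : Polynomial ℂ) = C (Real.cos ω : ℂ) * C (Real.cos ω : ℂ) := by
        rw [← C_mul, hsq, C_1]
      rw [this, C_neg]; ring
  · refine ⟨1, one_ne_zero, ?_⟩
    rw [diffRoots, Finset.prod_pair (exp_ne_exp_neg h h0)]
    simp only [Polynomial.map_sub, Polynomial.map_add, Polynomial.map_one, Polynomial.map_mul,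
      map_C, map_X, Polynomial.map_pow, Complex.coe_algebraMap, C_1, one_mul]
    have hp : Complex.exp (Complex.I * ω) * Complex.exp (-(Complex.I * ω)) = 1 := by
      rw [← Complex.exp_add]; simp
    have hs : Complex.exp (Complex.I * ω) + Complex.exp (-(Complex.I * ω)) =
        ((2 * Real.cos ω : ℝ) : ℂ) := by
      rw [Complex.ofReal_mul, Complex.ofReal_cos, Complex.cos]
      push_cast
      rw [mul_comm Complex.I]; ring_nf
    rw [← hs, show (1 : Polynomial ℂ) = C (Complex.exp (Complex.I * ω)) *
      C (Complex.exp (-(Complex.I * ω))) by rw [← C_mul, hp, C_1], C_add]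
    ring

open Polynomial in
/-- A finite product of powers of the `diffPoly ω`, over the complex numbers. -/
theorem prod_diffPoly_map {S : Finset ℝ} (hS : ∀ ω ∈ S, ω ∈ Icc 0 π) (d : ℝ → ℕ) :
    ∃ c : ℂ, c ≠ 0 ∧ (∏ ω ∈ S, diffPoly ω ^ d ω).map (algebraMap ℝ ℂ) =
      C c * ∏ ω ∈ S, ∏ z ∈ diffRoots ω, (X - C z) ^ d ω := by
  classical
  choose! c hc0 hc using fun ω (h : ω ∈ Icc 0 π) => diffPoly_map h
  refine ⟨∏ ω ∈ S, c ω ^ d ω, Finset.prod_ne_zero_iff.2 fun ω hω => pow_ne_zero _ (hc0 ω (hS ω hω)),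
    ?_⟩
  rw [Polynomial.map_prod, map_prod, ← Finset.prod_mul_distrib]
  refine Finset.prod_congr rfl fun ω hω => ?_
  rw [Polynomial.map_pow, hc ω (hS ω hω), mul_pow, Finset.prod_pow, map_pow]

theorem trigSum_conj (v : EuclideanSpace ℝ (Fin n)) (s : ℕ) (z : ℂ) :
    trigSum v s (starRingEnd ℂ z) = starRingEnd ℂ (trigSum v s z) := by
  simp [trigSum]

theorem trigSum_exp (v : EuclideanSpace ℝ (Fin n)) (s : ℕ) (ω : ℝ) :
    trigSum v s (Complex.exp (Complex.I * ω)) =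
      (inner ℝ (WithLp.toLp 2 ((trigMatrix n s ω).col 0)) v : ℝ) +
        (inner ℝ (WithLp.toLp 2 ((trigMatrix n s ω).col 1)) v : ℝ) * Complex.I := by
  simp only [trigSum, PiLp.inner_apply, trigMatrix, Matrix.col_apply, Matrix.of_apply,
    Matrix.cons_val_zero, Matrix.cons_val_one, Complex.ofReal_sum, Finset.sum_mul,
    ← Finset.sum_add_distrib]
  refine Finset.sum_congr rfl fun j _ => ?_
  rw [← Complex.exp_nat_mul, show ((((j : ℕ) + 1 : ℕ) : ℂ) * (Complex.I * ω)) =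
    ((((j : ℝ) + 1) * ω : ℝ) : ℂ) * Complex.I by push_cast; ring, Complex.exp_mul_I,
    ← Complex.ofReal_cos, ← Complex.ofReal_sin]
  simp only [RCLike.inner_apply, conj_trivial]
  push_cast
  ring

/-- The real and imaginary parts of the sum at `e^{iω}` are the inner products with the two columns.
Since `v` is real, passing to the conjugate zero only conjugates the sum. -/
theorem mem_trigSpan_orthogonal_iff (v : EuclideanSpace ℝ (Fin n)) (s : ℕ) {ω : ℝ} {z : ℂ}
    (hz : z ∈ diffRoots ω) : v ∈ (trigSpan n s ω)ᗮ ↔ trigSum v s z = 0 := by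
  have h1 : trigSum v s z = 0 ↔ trigSum v s (Complex.exp (Complex.I * ω)) = 0 := by
    simp only [diffRoots, Finset.mem_insert, Finset.mem_singleton] at hz
    rcases hz with rfl | rfl
    · rfl
    · rw [show Complex.exp (-(Complex.I * ω)) =
        starRingEnd ℂ (Complex.exp (Complex.I * ω)) by rw [← Complex.exp_conj]; simp,
        trigSum_conj]
      simp
  rw [h1, trigSum_exp, Complex.ext_iff]
  simp only [trigSpan, Submodule.mem_orthogonal]
  constructor
  · intro h
    simp [h _ (Submodule.subset_span ⟨0, rfl⟩), h _ (Submodule.subset_span ⟨1, rfl⟩)]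
  · rintro ⟨h1, h2⟩ u hu
    simp at h1 h2
    induction hu using Submodule.span_induction with
    | mem x hx =>
      obtain ⟨c, rfl⟩ := hx
      fin_cases c
      · exact h1
      · exact h2
    | zero => simp
    | add x y _ _ hx hy => simp [inner_add_left, hx, hy]
    | smul a x _ hx => simp [inner_smul_left, hx]

open Polynomial in
theorem X_sub_C_pow_dvd_coeffPoly_iff_orthogonal (v : EuclideanSpace ℝ (Fin n)) (m : ℕ) {ω : ℝ}
    {z : ℂ} (hz : z ∈ diffRoots ω) :
    (X - C z) ^ m ∣ coeffPoly v ↔ ∀ s < m, v ∈ (trigSpan n s ω)ᗮ := by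
  rw [X_sub_C_pow_dvd_coeffPoly_iff (ne_zero_of_mem_diffRoots hz)]
  exact forall₂_congr fun s _ => (mem_trigSpan_orthogonal_iff v s hz).symm

open Polynomial in
theorem coeffPoly_coeff (v : EuclideanSpace ℝ (Fin n)) (j : Fin n) :
    (coeffPoly v).coeff j = v j := by
  simp [coeffPoly, coeff_C_mul, coeff_X_pow, ← Fin.ext_iff]

theorem coeffPoly_eq_zero_iff (v : EuclideanSpace ℝ (Fin n)) : coeffPoly v = 0 ↔ v = 0 := by
  constructor
  · intro h
    ext j
    have := coeffPoly_coeff v j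
    rw [h] at this
    simpa using this.symm
  · rintro rfl
    simp [coeffPoly]

open Polynomial in
theorem natDegree_coeffPoly_lt {v : EuclideanSpace ℝ (Fin n)} (hv : v ≠ 0) :
    (coeffPoly v).natDegree < n := by
  have h0 : coeffPoly v ≠ 0 := (coeffPoly_eq_zero_iff v).not.2 hv
  rw [natDegree_lt_iff_degree_lt h0, degree_lt_iff_coeff_zero]
  intro m hm
  simp only [coeffPoly, finsetSum_coeff, coeff_C_mul, coeff_X_pow]
  refine Finset.sum_eq_zero fun j _ => ?_
  rw [if_neg (by have := j.2; omega), mul_zero]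

/-! ### The differencing polynomial of a subspace -/

variable {L : Submodule ℝ (EuclideanSpace ℝ (Fin n))}

theorem trigSpan_le_of_lt_rho {s : ℕ} {ω : ℝ} (h : s < rho ω L) : trigSpan n s ω ≤ L := by
  by_contra hc
  exact Nat.notMem_of_lt_sInf h hc

theorem exists_ne_zero_mem_orthogonal (hL : L ≠ ⊤) : ∃ v ∈ Lᗮ, v ≠ 0 := by
  have : Lᗮ ≠ ⊥ := fun h => hL (Submodule.orthogonal_eq_bot_iff.1 h)
  exact Submodule.exists_mem_ne_zero_of_ne_bot this

open Polynomial in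
theorem X_sub_C_pow_rho_dvd_coeffPoly {v : EuclideanSpace ℝ (Fin n)} (hv : v ∈ Lᗮ) {ω : ℝ} {z : ℂ}
    (hz : z ∈ diffRoots ω) : (X - C z) ^ rho ω L ∣ coeffPoly v :=
  (X_sub_C_pow_dvd_coeffPoly_iff_orthogonal v _ hz).2 fun _ hs =>
    Submodule.orthogonal_le (trigSpan_le_of_lt_rho hs) hv

-- For a nonzero `v ∈ Lᗮ`, each exceptional frequency gives a zero `e^{iω}` of the nonzero
-- polynomial `coeffPoly v`.
open Polynomial in
theorem finite_exceptionalFreqs (hL : L ≠ ⊤) : (exceptionalFreqs L).Finite := by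
  obtain ⟨v, hv, hv0⟩ := exists_ne_zero_mem_orthogonal hL
  have hfin := finite_setOfPred_isRoot ((coeffPoly_eq_zero_iff v).not.2 hv0)
  refine Set.Finite.of_finite_image (f := fun ω : ℝ => Complex.exp (Complex.I * ω))
    (hfin.subset ?_) ?_
  · rintro _ ⟨ω, hω, rfl⟩
    refine dvd_iff_isRoot.1 (dvd_trans ?_ (X_sub_C_pow_rho_dvd_coeffPoly hv (exp_mem_diffRoots ω)))
    exact dvd_pow_self _ hω.2.ne'
  · intro ω hω ω' hω' he
    have h2 : Complex.exp (Complex.I * ω) ∈ diffRoots ω' := by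
      have : Complex.exp (Complex.I * ω) = Complex.exp (Complex.I * ω') := he
      rw [this]; exact exp_mem_diffRoots ω'
    exact disjoint_diffRoots hω.1 hω'.1 (exp_mem_diffRoots ω) h2

open Polynomial in
/-- Over `ℂ`, `diffPolyOf L` is a product of linear factors with multiplicities `rho ω L`. -/
theorem diffPolyOf_map (hL : L ≠ ⊤) :
    ∃ c : ℂ, c ≠ 0 ∧ (diffPolyOf L).map (algebraMap ℝ ℂ) =
      C c * ∏ ω ∈ (finite_exceptionalFreqs hL).toFinset,
        ∏ z ∈ diffRoots ω, (X - C z) ^ rho ω L := by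
  rw [diffPolyOf, finprod_mem_eq_finite_toFinset_prod _ (finite_exceptionalFreqs hL)]
  exact prod_diffPoly_map (fun ω hω => ((finite_exceptionalFreqs hL).mem_toFinset.1 hω).1) _

theorem kappaOf_eq (hL : L ≠ ⊤) :
    kappaOf L = ∑ ω ∈ (finite_exceptionalFreqs hL).toFinset, kappa ω (rho ω L) := by
  rw [kappaOf, finsum_mem_eq_finite_toFinset_sum _ (finite_exceptionalFreqs hL)]

open Polynomial in
theorem diffPolyOf_map_ne_zero (hL : L ≠ ⊤) : (diffPolyOf L).map (algebraMap ℝ ℂ) ≠ 0 := by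
  obtain ⟨c, hc, h⟩ := diffPolyOf_map hL
  rw [h]
  refine mul_ne_zero (C_ne_zero.2 hc) (Finset.prod_ne_zero_iff.2 fun ω _ =>
    Finset.prod_ne_zero_iff.2 fun z _ => pow_ne_zero _ (X_sub_C_ne_zero z))

-- This is the source of the term `κ̄` in the counting condition: it is the degree lost on division
-- by `Δ`.
open Polynomial in
theorem natDegree_diffPolyOf_map (hL : L ≠ ⊤) :
    ((diffPolyOf L).map (algebraMap ℝ ℂ)).natDegree = kappaOf L := by
  obtain ⟨c, hc, h⟩ := diffPolyOf_map hL
  rw [h, natDegree_C_mul hc, natDegree_prod_of_monic _ _ fun ω _ =>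
    monic_prod_of_monic _ _ fun z _ => (monic_X_sub_C z).pow _, kappaOf_eq hL]
  refine Finset.sum_congr rfl fun ω hω => ?_
  rw [natDegree_prod_of_monic _ _ fun z _ => (monic_X_sub_C z).pow _, kappa_eq,
    ← card_diffRoots ((finite_exceptionalFreqs hL).mem_toFinset.1 hω).1]
  simp [natDegree_pow, mul_comm]

-- Each linear factor divides with its multiplicity, and powers of factors with distinct zeros are
-- coprime.
open Polynomial in
theorem diffPolyOf_map_dvd_coeffPoly (hL : L ≠ ⊤) {v : EuclideanSpace ℝ (Fin n)} (hv : v ∈ Lᗮ) :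
    (diffPolyOf L).map (algebraMap ℝ ℂ) ∣ coeffPoly v := by
  obtain ⟨c, hc, h⟩ := diffPolyOf_map hL
  rw [h, (isUnit_C.2 hc.isUnit).mul_left_dvd]
  have hcop : ∀ z z' : ℂ, z ≠ z' → ∀ a b : ℕ, IsCoprime ((X - C z) ^ a) ((X - C z') ^ b) :=
    fun z z' hzz a b => IsCoprime.pow
      (isCoprime_X_sub_C_of_isUnit_sub (sub_ne_zero.2 hzz).isUnit)
  refine Finset.prod_dvd_of_coprime ?_ fun ω _ => Finset.prod_dvd_of_coprime ?_ fun z hz =>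
    X_sub_C_pow_rho_dvd_coeffPoly hv hz
  · intro ω hω ω' hω' hne
    simp only [Finite.coe_toFinset] at hω hω'
    refine IsCoprime.prod_left fun z hz => IsCoprime.prod_right fun z' hz' => hcop _ _ ?_ _ _
    rintro rfl
    exact hne (disjoint_diffRoots hω.1 hω'.1 hz hz')
  · intro z _ z' _ hne
    exact hcop _ _ hne _ _

open Polynomial in
/-- `e^{± i γ}` is a zero of `diffPolyOf L` of multiplicity exactly `rho γ L`. -/
theorem diffPolyOf_map_eq_pow_mul (hL : L ≠ ⊤) {γ : ℝ} (hγ : γ ∈ Icc 0 π) {z : ℂ}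
    (hz : z ∈ diffRoots γ) :
    ∃ u : Polynomial ℂ, u.eval z ≠ 0 ∧
      (diffPolyOf L).map (algebraMap ℝ ℂ) = (X - C z) ^ rho γ L * u := by
  classical
  obtain ⟨c, hc, h⟩ := diffPolyOf_map hL
  have hmem : ∀ ω ∈ (finite_exceptionalFreqs hL).toFinset, ω ∈ Icc 0 π := fun ω hω =>
    ((finite_exceptionalFreqs hL).mem_toFinset.1 hω).1
  have hrest : ∀ S ⊆ (finite_exceptionalFreqs hL).toFinset, γ ∉ S →
      (∏ ω ∈ S, ∏ z ∈ diffRoots ω, (X - C z) ^ rho ω L).eval z ≠ 0 := by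
    intro S hS hγS
    simp only [eval_prod, eval_pow, eval_sub, eval_X, eval_C]
    refine Finset.prod_ne_zero_iff.2 fun ω hω => Finset.prod_ne_zero_iff.2 fun z' hz' =>
      pow_ne_zero _ (sub_ne_zero.2 ?_)
    rintro rfl
    exact hγS (disjoint_diffRoots hγ (hmem ω (hS hω)) hz hz' ▸ hω)
  by_cases hex : γ ∈ (finite_exceptionalFreqs hL).toFinset
  · refine ⟨C c * (∏ z' ∈ (diffRoots γ).erase z, (X - C z') ^ rho γ L) *
      ∏ ω ∈ (finite_exceptionalFreqs hL).toFinset.erase γ,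
        ∏ z ∈ diffRoots ω, (X - C z) ^ rho ω L, ?_, ?_⟩
    · rw [eval_mul, eval_mul, eval_C]
      refine mul_ne_zero (mul_ne_zero hc ?_) (hrest _ (Finset.erase_subset _ _) (by simp))
      simp only [eval_prod, eval_pow, eval_sub, eval_X, eval_C]
      exact Finset.prod_ne_zero_iff.2 fun z' hz' =>
        pow_ne_zero _ (sub_ne_zero.2 (Finset.ne_of_mem_erase hz').symm)
    · rw [h, ← Finset.mul_prod_erase _ _ hex, ← Finset.mul_prod_erase _ _ hz]
      ring
  · have h0 : rho γ L = 0 := by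
      by_contra h0
      exact hex ((finite_exceptionalFreqs hL).mem_toFinset.2 ⟨hγ, Nat.pos_of_ne_zero h0⟩)
    refine ⟨_, ?_, by rw [h0, pow_zero, one_mul]⟩
    rw [h, eval_mul, eval_C]
    exact mul_ne_zero hc (hrest _ (Finset.Subset.refl _) hex)

open Polynomial in
/-- The quotient of the coefficient polynomial of `v ∈ Lᗮ` by `diffPolyOf L` vanishes at `e^{± i γ}`
exactly if `v` is orthogonal to the span of `E_{n,ρ(γ)}(γ)`. -/
theorem eval_quotient_eq_zero_iff (hL : L ≠ ⊤) {v : EuclideanSpace ℝ (Fin n)} (hv : v ∈ Lᗮ)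
    {w : Polynomial ℂ} (hw : coeffPoly v = (diffPolyOf L).map (algebraMap ℝ ℂ) * w) {γ : ℝ}
    (hγ : γ ∈ Icc 0 π) {z : ℂ} (hz : z ∈ diffRoots γ) :
    w.eval z = 0 ↔ v ∈ (trigSpan n (rho γ L) γ)ᗮ := by
  obtain ⟨u, hu, h⟩ := diffPolyOf_map_eq_pow_mul hL hγ hz
  -- Since `Δ` has a zero of order exactly `ρ(γ)` at `z`, a zero of `w` there is one more order of
  -- vanishing of `coeffPoly v`.
  have h1 : w.eval z = 0 ↔ (X - C z) ^ (rho γ L + 1) ∣ coeffPoly v := by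
    rw [hw, h, pow_succ, mul_assoc,
      mul_dvd_mul_iff_left (pow_ne_zero _ (X_sub_C_ne_zero z)), dvd_iff_isRoot, IsRoot.def,
      eval_mul, mul_eq_zero]
    simp [hu]
  rw [h1, X_sub_C_pow_dvd_coeffPoly_iff_orthogonal v _ hz]
  constructor
  · exact fun h => h _ (Nat.lt_succ_self _)
  -- The orders below `ρ(γ)` are automatic, because the corresponding spans lie in `L`.
  · intro h s hs
    rcases Nat.lt_succ_iff_lt_or_eq.1 hs with hs | rfl
    · exact Submodule.orthogonal_le (trigSpan_le_of_lt_rho hs) hv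
    · exact h

end CoefficientPolynomials

/-! ### Null sets -/

theorem pi_absolutelyContinuous {n : ℕ} {μ ν : Fin n → Measure ℝ} [∀ i, SigmaFinite (μ i)]
    [∀ i, SigmaFinite (ν i)] (h : ∀ i, μ i ≪ ν i) : Measure.pi μ ≪ Measure.pi ν := by
  induction n with
  | zero => rw [Measure.pi_of_empty μ, Measure.pi_of_empty ν]
  | succ n ih =>
    have h1 := (measurePreserving_piFinSuccAbove μ 0).symm
    have h2 := (measurePreserving_piFinSuccAbove ν 0).symm
    rw [← h1.map_eq, ← h2.map_eq]
    exact ((h 0).prod (ih fun i => h _)).map (MeasurableEquiv.measurable _)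

theorem stdGaussian_absolutelyContinuous {n : ℕ} :
    stdGaussian (EuclideanSpace ℝ (Fin n)) ≪ volume := by
  rw [← map_pi_eq_stdGaussian, ← (PiLp.volume_preserving_toLp (Fin n)).map_eq]
  refine (pi_absolutelyContinuous fun _ => ?_).map (by fun_prop)
  exact gaussianReal_absolutelyContinuous 0 one_ne_zero

/-! ### Genericity for linear maps modulo a subspace of translations -/

section GeneralPosition

variable {E V W : Type*} [NormedAddCommGroup E] [NormedSpace ℝ E] [FiniteDimensional ℝ E]
  [MeasurableSpace E] [BorelSpace E]
  [NormedAddCommGroup V] [NormedSpace ℝ V] [FiniteDimensional ℝ V] [MeasurableSpace V]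
  [BorelSpace V] [NormedAddCommGroup W] [NormedSpace ℝ W] [FiniteDimensional ℝ W]
  [MeasurableSpace W] [BorelSpace W]

/-- Adding an independent variable `l ∈ L` changes nothing, by invariance of `N`. The map `(v, l) ↦
f v + l` is onto `S`, and a surjective linear map preserves and reflects conull sets; Fubini
connects the two. -/
theorem ae_notMem_iff_ae_range_sup (μ : Measure V) [μ.IsAddHaarMeasure] (f : V →ₗ[ℝ] E)
    (L S : Submodule ℝ E) (hS : LinearMap.range f ⊔ L = S) (ν : Measure S) [ν.IsAddHaarMeasure]
    {N : Set E} (hN : MeasurableSet N) (hinv : ∀ y, ∀ l ∈ L, y + l ∈ N ↔ y ∈ N) :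
    (∀ᵐ v ∂μ, f v ∉ N) ↔ ∀ᵐ y : S ∂ν, (y : E) ∉ N := by
  have hmem : ∀ p : V × L, (f.coprod L.subtype) p ∈ S := fun p => by
    rw [← hS]
    exact Submodule.add_mem_sup (LinearMap.mem_range_self f p.1) p.2.2
  let g : V × L →ₗ[ℝ] S := (f.coprod L.subtype).codRestrict S hmem
  have hg : Function.Surjective g := by
    rintro ⟨y, hy⟩
    rw [← hS] at hy
    obtain ⟨_, ⟨v, rfl⟩, l, hl, rfl⟩ := Submodule.mem_sup.1 hy
    exact ⟨(v, ⟨l, hl⟩), rfl⟩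
  let ξ : Measure L := Measure.addHaar
  have hmeas : MeasurableSet {y : S | (y : E) ∉ N} := measurable_subtype_coe hN.compl
  have h1 := ae_comp_linearMap_mem_iff g (μ.prod ξ) ν hg hmeas
  have hgm : MeasurableSet (g ⁻¹' {y : S | (y : E) ∉ N}) :=
    g.continuous_of_finiteDimensional.measurable hmeas
  have h2 := Measure.ae_prod_mem_iff_ae_ae_mem (μ := μ) (ν := ξ) hgm
  refine Iff.trans ?_ (h2.symm.trans h1)
  refine eventually_congr (Eventually.of_forall fun v => ?_)
  have h3 : ∀ l : L, (v, l) ∈ g ⁻¹' {y : S | (y : E) ∉ N} ↔ f v ∉ N := fun l => by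
    change f v + (l : E) ∉ N ↔ _
    rw [hinv _ _ l.2]
  simp only [h3, eventually_const]

/-- Membership in a set that is invariant under translations by `L` is generic for a linear map `f`
whenever it is for a linear map `g` with the same range modulo `L`. -/
theorem ae_notMem_iff_of_range_sup_eq (μ : Measure V) [μ.IsAddHaarMeasure] (ν : Measure W)
    [ν.IsAddHaarMeasure] (f : V →ₗ[ℝ] E) (g : W →ₗ[ℝ] E) (L : Submodule ℝ E)
    (h : LinearMap.range f ⊔ L = LinearMap.range g ⊔ L)
    {N : Set E} (hN : MeasurableSet N) (hinv : ∀ y, ∀ l ∈ L, y + l ∈ N ↔ y ∈ N) :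
    (∀ᵐ v ∂μ, f v ∉ N) ↔ ∀ᵐ w ∂ν, g w ∉ N :=
  (ae_notMem_iff_ae_range_sup μ f L _ h Measure.addHaar hN hinv).trans
    (ae_notMem_iff_ae_range_sup ν g L _ rfl Measure.addHaar hN hinv).symm

end GeneralPosition

theorem lebesgueOn_eq_zero_iff {n : ℕ} (S : Submodule ℝ (EuclideanSpace ℝ (Fin n)))
    {N : Set (EuclideanSpace ℝ (Fin n))} (hN : MeasurableSet N) :
    lebesgueOn S N = 0 ↔
      ∀ᵐ x : S ∂(stdOrthonormalBasis ℝ S).toBasis.addHaar, (x : EuclideanSpace ℝ (Fin n)) ∉ N := by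
  rw [lebesgueOn, Measure.map_apply measurable_subtype_coe hN, ae_iff]
  simp only [not_not]
  rfl

/-! ### The test statistic -/

section Statistic

variable {n k q : ℕ} {X : Matrix (Fin n) (Fin k) ℝ} {N : Set (EuclideanSpace ℝ (Fin n))}
  {βc : EuclideanSpace ℝ (Fin n) → Fin k → ℝ}
  {Ωc : EuclideanSpace ℝ (Fin n) → Matrix (Fin q) (Fin q) ℝ}

theorem compl_nStar_eq : (nStar N Ωc)ᶜ = Nᶜ ∩ Ωc ⁻¹' {A | A.det ≠ 0} := by
  ext y
  simp only [nStar, mem_compl_iff, mem_union, mem_ofPred_eq, mem_inter_iff, mem_preimage]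
  tauto

theorem EstimatorAssumption.isClosed_nStar (h : EstimatorAssumption X N βc Ωc) :
    IsClosed (nStar N Ωc) := by
  rw [← isOpen_compl_iff, compl_nStar_eq]
  refine h.continuousOn_omega.isOpen_inter_preimage h.isClosed.isOpen_compl ?_
  exact isOpen_ne.preimage (continuous_id.matrix_det)

theorem EstimatorAssumption.ae_notMem_nStar (h : EstimatorAssumption X N βc Ωc) :
    ∀ᵐ y, y ∉ nStar N Ωc := by
  have h1 : ∀ᵐ y, y ∉ N := measure_eq_zero_iff_ae_notMem.1 h.null
  filter_upwards [h1, h.ae_nonsingular] with y hy hy'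
  rw [← mem_compl_iff, compl_nStar_eq]
  exact ⟨hy, hy' hy⟩

theorem EstimatorAssumption.smul_add_mem_compl_nStar (h : EstimatorAssumption X N βc Ωc)
    {y : EuclideanSpace ℝ (Fin n)} (hy : y ∈ (nStar N Ωc)ᶜ) {δ : ℝ} (hδ : δ ≠ 0)
    (η : Fin k → ℝ) : δ • y + meanVec X η ∈ (nStar N Ωc)ᶜ := by
  rw [compl_nStar_eq] at hy ⊢
  refine ⟨h.invariant y hy.1 δ hδ η, ?_⟩
  have h2 : (Ωc y).det ≠ 0 := hy.2
  change (Ωc (δ • y + meanVec X η)).det ≠ 0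
  rw [h.omega_equivariant y hy.1 δ hδ η, Matrix.det_smul]
  exact mul_ne_zero (pow_ne_zero _ (pow_ne_zero _ hδ)) h2

theorem meanVec_neg (η : Fin k → ℝ) : meanVec X (-η) = -meanVec X η := by
  simp [meanVec, Matrix.mulVec_neg]

theorem meanVec_smul (a : ℝ) (η : Fin k → ℝ) : meanVec X (a • η) = a • meanVec X η := by
  simp [meanVec, Matrix.mulVec_smul]

theorem EstimatorAssumption.smul_add_mem_nStar_iff (h : EstimatorAssumption X N βc Ωc)
    (y : EuclideanSpace ℝ (Fin n)) {δ : ℝ} (hδ : δ ≠ 0) (η : Fin k → ℝ) :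
    δ • y + meanVec X η ∈ nStar N Ωc ↔ y ∈ nStar N Ωc := by
  refine not_iff_not.1 ⟨fun hy => ?_, fun hy => h.smul_add_mem_compl_nStar hy hδ η⟩
  have := h.smul_add_mem_compl_nStar hy (inv_ne_zero hδ) (-(δ⁻¹ • η))
  rwa [smul_add, smul_smul, inv_mul_cancel₀ hδ, one_smul, meanVec_neg, meanVec_smul,
    add_neg_cancel_right] at this

theorem EstimatorAssumption.add_mem_nStar_iff (h : EstimatorAssumption X N βc Ωc)
    (R : Matrix (Fin q) (Fin k) ℝ) (y l : EuclideanSpace ℝ (Fin n)) (hl : l ∈ nullMeansLin X R) :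
    y + l ∈ nStar N Ωc ↔ y ∈ nStar N Ωc := by
  obtain ⟨η, rfl, -⟩ := hl
  simpa using h.smul_add_mem_nStar_iff y one_ne_zero η

/-- The statistic for `R β = r` is invariant under the group generated by the null hypothesis. -/
theorem EstimatorAssumption.fTypeStat_smul_add (h : EstimatorAssumption X N βc Ωc)
    {R : Matrix (Fin q) (Fin k) ℝ} {r : Fin q → ℝ} (y : EuclideanSpace ℝ (Fin n)) {δ : ℝ}
    (hδ : δ ≠ 0) {η : Fin k → ℝ} (hη : R *ᵥ η = r) :
    fTypeStat R r N βc Ωc (δ • y + meanVec X η) = fTypeStat R 0 N βc Ωc y := by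
  have hiff := h.smul_add_mem_nStar_iff y hδ η
  unfold fTypeStat
  by_cases hy : y ∈ nStar N Ωc
  · rw [if_pos (hiff.2 hy), if_pos hy]
  rw [if_neg (hiff.not.2 hy), if_neg hy]
  rw [← mem_compl_iff, compl_nStar_eq] at hy
  have hdet : (Ωc y).det ≠ 0 := hy.2
  rw [h.beta_equivariant y hy.1 δ hδ η, h.omega_equivariant y hy.1 δ hδ η, Matrix.mulVec_add,
    Matrix.mulVec_smul, hη, add_sub_cancel_right, sub_zero]
  have hinv : (δ ^ 2 • Ωc y)⁻¹ = (δ ^ 2)⁻¹ • (Ωc y)⁻¹ := by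
    refine Matrix.inv_eq_left_inv ?_
    rw [smul_mul_smul_comm, inv_mul_cancel₀ (pow_ne_zero _ hδ), one_smul,
      Matrix.nonsing_inv_mul _ hdet.isUnit]
  rw [hinv, Matrix.smul_mulVec, Matrix.mulVec_smul, smul_dotProduct, dotProduct_smul,
    dotProduct_smul]
  simp only [smul_eq_mul]
  field_simp

theorem EstimatorAssumption.continuousOn_fTypeStat (h : EstimatorAssumption X N βc Ωc)
    (R : Matrix (Fin q) (Fin k) ℝ) (r : Fin q → ℝ) :
    ContinuousOn (fTypeStat R r N βc Ωc) (nStar N Ωc)ᶜ := by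
  have hsub : (nStar N Ωc)ᶜ ⊆ Nᶜ := by rw [compl_nStar_eq]; exact inter_subset_left
  have hβ := h.continuousOn_beta.mono hsub
  have hΩ := h.continuousOn_omega.mono hsub
  have hR : Continuous fun b : Fin k → ℝ => R *ᵥ b := by fun_prop
  have hlin : ContinuousOn (fun y => R *ᵥ βc y - r) (nStar N Ωc)ᶜ :=
    (hR.comp_continuousOn hβ).sub continuousOn_const
  have hinv : ContinuousOn (fun y => (Ωc y)⁻¹) (nStar N Ωc)ᶜ := by
    -- The adjugate formula makes the inverse continuous wherever the determinant is nonzero.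
    have h1 : ∀ y, (Ωc y)⁻¹ = (Ωc y).det⁻¹ • (Ωc y).adjugate := fun y => by
      rw [Matrix.inv_def, Ring.inverse_eq_inv']
    simp only [h1]
    have hdet : ContinuousOn (fun y => (Ωc y).det) (nStar N Ωc)ᶜ :=
      (Continuous.matrix_det continuous_id).comp_continuousOn hΩ
    have hadj : ContinuousOn (fun y => (Ωc y).adjugate) (nStar N Ωc)ᶜ :=
      (Continuous.matrix_adjugate continuous_id).comp_continuousOn hΩ
    refine (hdet.inv₀ fun y hy => ?_).smul hadj
    rw [compl_nStar_eq] at hy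
    exact hy.2
  have hc : Continuous fun p : (Fin q → ℝ) × Matrix (Fin q) (Fin q) ℝ => p.1 ⬝ᵥ (p.2 *ᵥ p.1) := by
    fun_prop
  refine (hc.comp_continuousOn (hlin.prodMk hinv)).congr fun y hy => ?_
  simp [fTypeStat, show y ∉ nStar N Ωc from hy]

theorem EstimatorAssumption.measurable_fTypeStat (h : EstimatorAssumption X N βc Ωc)
    (R : Matrix (Fin q) (Fin k) ℝ) (r : Fin q → ℝ) : Measurable (fTypeStat R r N βc Ωc) := by
  classical
  have h1 := (continuousOn_const (c := (0 : ℝ)) (s := nStar N Ωc)).measurable_piecewise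
    (h.continuousOn_fTypeStat R r) h.isClosed_nStar.measurableSet
  convert h1 using 1
  ext y
  by_cases hy : y ∈ nStar N Ωc <;> simp [fTypeStat, hy]

end Statistic

section SpectralDensities

/-! ### Squared moduli of polynomials on the unit circle -/

/-- `ν ↦ |w(e^{iν})|²`, as a bounded continuous function. -/
noncomputable def polyNormSq (w : Polynomial ℂ) : BoundedContinuousFunction ℝ ℝ :=
  (BoundedContinuousFunction.mkOfCompact
    ⟨fun z : Circle => ‖w.eval (z : ℂ)‖ ^ 2, by
      exact ((w.continuous.comp continuous_subtype_val).norm).pow 2⟩).compContinuous Circle.exp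

theorem polyNormSq_apply (w : Polynomial ℂ) (ν : ℝ) :
    polyNormSq w ν = ‖w.eval (Complex.exp (Complex.I * ν))‖ ^ 2 := by
  change ‖w.eval (Circle.exp ν : ℂ)‖ ^ 2 = _
  rw [Circle.coe_exp, mul_comm]

theorem polyNormSq_nonneg (w : Polynomial ℂ) (ν : ℝ) : 0 ≤ polyNormSq w ν := by
  rw [polyNormSq_apply]; positivity

theorem polyNormSq_eq_zero_iff (w : Polynomial ℂ) (ν : ℝ) :
    polyNormSq w ν = 0 ↔ w.eval (Complex.exp (Complex.I * ν)) = 0 := by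
  simp [polyNormSq_apply]

theorem polyNormSq_mul (w u : Polynomial ℂ) (ν : ℝ) :
    polyNormSq (w * u) ν = polyNormSq w ν * polyNormSq u ν := by
  simp [polyNormSq_apply, mul_pow]

theorem finite_zeros_on_circle {w : Polynomial ℂ} (hw : w ≠ 0) :
    {ν | ν ∈ Icc (-π) π ∧ w.eval (Complex.exp (Complex.I * ν)) = 0}.Finite := by
  -- The argument takes values in `(-π, π]`, so the endpoint `-π` has to be added by hand.
  refine Set.Finite.subset
    (((Polynomial.finite_setOfPred_isRoot hw).image Complex.arg).insert (-π)) ?_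
  rintro ν ⟨hν, h0⟩
  rcases eq_or_lt_of_le hν.1 with h | h
  · exact Or.inl h.symm
  · refine Or.inr ⟨Complex.exp (Complex.I * ν), h0, ?_⟩
    rw [mul_comm, Complex.arg_exp_mul_I, toIocMod_eq_self]
    exact ⟨h, by linarith [hν.2]⟩

theorem setIntegral_Icc_comp_neg (h : ℝ → ℝ) :
    ∫ ν in Icc (-π) π, h (-ν) = ∫ ν in Icc (-π) π, h ν := by
  have hle : -π ≤ π := by linarith [Real.pi_pos]
  rw [integral_Icc_eq_integral_Ioc, integral_Icc_eq_integral_Ioc,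
    ← intervalIntegral.integral_of_le hle, ← intervalIntegral.integral_of_le hle,
    intervalIntegral.integral_comp_neg, neg_neg]

/-! ### Covariance matrices -/

variable {n : ℕ}

theorem covMatrix_apply {f : ℝ → ℝ} (hf : IntegrableOn f (Icc (-π) π)) (j l : Fin n) :
    covMatrix n f j l = ∫ ν in Icc (-π) π, Real.cos (((j : ℝ) - l) * ν) * f ν := by
  have hint : IntegrableOn (fun ν : ℝ =>
      Complex.exp (-(Complex.I * ((j : ℂ) - (l : ℂ)) * ν)) * (f ν : ℂ)) (Icc (-π) π) := by
    refine Integrable.bdd_mul (c := 1) hf.ofReal (by fun_prop) (Eventually.of_forall fun ν => ?_)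
    rw [Complex.norm_exp]
    simp
  have := integral_re hint
  simp only [RCLike.re_eq_complex_re] at this
  rw [covMatrix, Matrix.of_apply, ← this]
  refine integral_congr_ae (Eventually.of_forall fun ν => ?_)
  simp only [Complex.re_mul_ofReal, Complex.exp_re]
  simp

/-- Expand `p_v` times its conjugate; the real part of `e^{i(j-l)ν}` is the cosine. -/
theorem polyNormSq_coeffPoly (v : EuclideanSpace ℝ (Fin n)) (ν : ℝ) :
    polyNormSq (coeffPoly v) ν =
      ∑ j : Fin n, ∑ l : Fin n, v j * (Real.cos (((j : ℝ) - l) * ν) * v l) := by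
  rw [polyNormSq_apply, ← Complex.ofReal_re (_ ^ 2), Complex.ofReal_pow, ← Complex.mul_conj']
  have h1 : (coeffPoly v).eval (Complex.exp (Complex.I * ν)) =
      ∑ j : Fin n, (v j : ℂ) * Complex.exp (Complex.I * ν) ^ (j : ℕ) := by
    simp [coeffPoly, Polynomial.eval_finsetSum]
  rw [h1, map_sum, Finset.sum_mul_sum, Complex.re_sum]
  refine Finset.sum_congr rfl fun j _ => ?_
  rw [Complex.re_sum]
  refine Finset.sum_congr rfl fun l _ => ?_
  rw [map_mul, map_pow, Complex.conj_ofReal, ← Complex.exp_conj, ← Complex.exp_nat_mul,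
    ← Complex.exp_nat_mul, mul_mul_mul_comm, ← Complex.exp_add, ← Complex.ofReal_mul,
    Complex.re_ofReal_mul, Complex.exp_re]
  have h2 : ((j : ℕ) : ℂ) * (Complex.I * ν) + ((l : ℕ) : ℂ) * (starRingEnd ℂ) (Complex.I * ν) =
      ((((j : ℝ) - l) * ν : ℝ) : ℂ) * Complex.I := by
    simp; ring
  rw [h2]
  simp only [Complex.re_ofReal_mul, Complex.I_re, mul_zero, Real.exp_zero, one_mul,
    Complex.im_ofReal_mul, Complex.I_im, mul_one]
  ring

theorem integrableOn_polyNormSq_mul (w : Polynomial ℂ) {f : ℝ → ℝ}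
    (hf : IntegrableOn f (Icc (-π) π)) :
    IntegrableOn (fun ν => polyNormSq w ν * f ν) (Icc (-π) π) :=
  Integrable.bdd_mul (c := ‖polyNormSq w‖) hf (polyNormSq w).continuous.aestronglyMeasurable
    (Eventually.of_forall fun ν => (polyNormSq w).norm_coe_le_norm ν)

theorem integrableOn_cos_mul {f : ℝ → ℝ} (hf : IntegrableOn f (Icc (-π) π)) (a : ℝ) :
    IntegrableOn (fun ν => Real.cos (a * ν) * f ν) (Icc (-π) π) :=
  Integrable.bdd_mul (c := 1) hf (by fun_prop)
    (Eventually.of_forall fun ν => Real.abs_cos_le_one _)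

/-- The quadratic form of `covMatrix n f` is `v ↦ ∫ |p_v(e^{iν})|² f(ν) dν`. -/
theorem dotProduct_covMatrix_mulVec {f : ℝ → ℝ} (hf : IntegrableOn f (Icc (-π) π))
    (v : EuclideanSpace ℝ (Fin n)) :
    v.ofLp ⬝ᵥ (covMatrix n f *ᵥ v.ofLp) =
      ∫ ν in Icc (-π) π, polyNormSq (coeffPoly v) ν * f ν := by
  simp only [polyNormSq_coeffPoly, Finset.sum_mul]
  have hint : ∀ j l : Fin n, IntegrableOn
      (fun ν => v j * (Real.cos (((j : ℝ) - l) * ν) * v l) * f ν) (Icc (-π) π) := fun j l => by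
    have := ((integrableOn_cos_mul hf ((j : ℝ) - l)).const_mul (v j * v l))
    refine this.congr (Eventually.of_forall fun ν => ?_)
    simp only; ring
  rw [integral_finsetSum _ fun j _ => integrable_finsetSum _ fun l _ => hint j l]
  simp only [dotProduct, Matrix.mulVec, Finset.mul_sum]
  refine Finset.sum_congr rfl fun j _ => ?_
  rw [integral_finsetSum _ fun l _ => hint j l]
  refine Finset.sum_congr rfl fun l _ => ?_
  rw [covMatrix_apply hf, ← integral_mul_const, ← integral_const_mul]
  refine integral_congr_ae (Eventually.of_forall fun ν => ?_)
  simp only; ring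

theorem posSemidef_covMatrix {f : ℝ → ℝ} (hf : IsNormalizedSpectralDensity f) :
    (covMatrix n f).PosSemidef := by
  refine Matrix.PosSemidef.of_dotProduct_mulVec_nonneg ?_ fun x => ?_
  · ext j l
    rw [Matrix.conjTranspose_apply, star_trivial, covMatrix_apply hf.integrable,
      covMatrix_apply hf.integrable]
    refine integral_congr_ae (Eventually.of_forall fun ν => ?_)
    simp only
    rw [← Real.cos_neg]; congr 2; ring
  · have := dotProduct_covMatrix_mulVec hf.integrable (WithLp.toLp 2 x)
    rw [star_trivial]
    simp only at this
    rw [this]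
    exact setIntegral_nonneg measurableSet_Icc fun ν hν =>
      mul_nonneg (polyNormSq_nonneg _ _) (hf.nonneg ν hν)

/-! ### Filtered densities -/

variable {L : Submodule ℝ (EuclideanSpace ℝ (Fin n))} {f : ℝ → ℝ}

theorem filteredDensity_eq (L : Submodule ℝ (EuclideanSpace ℝ (Fin n))) (f : ℝ → ℝ) (ν : ℝ) :
    filteredDensity L f ν = polyNormSq ((diffPolyOf L).map (algebraMap ℝ ℂ)) ν * f ν := by
  rw [filteredDensity, polyNormSq_apply, Polynomial.eval_map_algebraMap]

theorem polyNormSq_map_neg (p : Polynomial ℝ) (ν : ℝ) :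
    polyNormSq (p.map (algebraMap ℝ ℂ)) (-ν) = polyNormSq (p.map (algebraMap ℝ ℂ)) ν := by
  rw [polyNormSq_apply, polyNormSq_apply]
  have : Complex.exp (Complex.I * ((-ν : ℝ) : ℂ)) =
      starRingEnd ℂ (Complex.exp (Complex.I * ν)) := by
    rw [← Complex.exp_conj]; simp
  rw [this, Polynomial.eval_map_algebraMap, Polynomial.eval_map_algebraMap,
    Polynomial.aeval_conj, RCLike.norm_conj]

theorem filteredDensity_nonneg (hf : IsNormalizedSpectralDensity f) {ν : ℝ}
    (hν : ν ∈ Icc (-π) π) : 0 ≤ filteredDensity L f ν := by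
  rw [filteredDensity_eq]
  exact mul_nonneg (polyNormSq_nonneg _ _) (hf.nonneg ν hν)

theorem integrableOn_filteredDensity (hf : IsNormalizedSpectralDensity f) :
    IntegrableOn (filteredDensity L f) (Icc (-π) π) := by
  simp only [funext fun ν => filteredDensity_eq L f ν]
  exact integrableOn_polyNormSq_mul _ hf.integrable

/-- `Δ` has only finitely many zeros on the circle, so a vanishing integral would force `f = 0`
almost everywhere, against its total mass one. -/
theorem integral_filteredDensity_pos (hL : L ≠ ⊤) (hf : IsNormalizedSpectralDensity f) :
    0 < ∫ ν in Icc (-π) π, filteredDensity L f ν := by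
  have hnn : 0 ≤ᵐ[volume.restrict (Icc (-π) π)] filteredDensity L f :=
    (ae_restrict_mem measurableSet_Icc).mono fun ν hν => filteredDensity_nonneg hf hν
  refine lt_of_le_of_ne (integral_nonneg_of_ae hnn) fun h0 => ?_
  have h1 := (integral_eq_zero_iff_of_nonneg_ae hnn (integrableOn_filteredDensity hf)).1 h0.symm
  have h2 : ∀ᵐ ν ∂volume.restrict (Icc (-π) π), f ν = 0 := by
    have hz := (finite_zeros_on_circle (diffPolyOf_map_ne_zero hL)).measure_zero
      (volume.restrict (Icc (-π) π))
    filter_upwards [h1, measure_eq_zero_iff_ae_notMem.1 hz, ae_restrict_mem measurableSet_Icc]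
      with ν h3 h4 h5
    rw [filteredDensity_eq, Pi.zero_apply, mul_eq_zero, polyNormSq_eq_zero_iff] at h3
    exact h3.resolve_left fun h => h4 ⟨h5, h⟩
  have h3 := hf.integral_eq_one
  rw [integral_congr_ae (g := fun _ => (0 : ℝ)) h2] at h3
  simp at h3

theorem normalizedFilteredDensity_nonneg (hf : IsNormalizedSpectralDensity f) {ν : ℝ}
    (hν : ν ∈ Icc (-π) π) : 0 ≤ normalizedFilteredDensity L f ν :=
  div_nonneg (filteredDensity_nonneg hf hν)
    (setIntegral_nonneg measurableSet_Icc fun _ hx => filteredDensity_nonneg hf hx)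

theorem integrableOn_normalizedFilteredDensity (hf : IsNormalizedSpectralDensity f) :
    IntegrableOn (normalizedFilteredDensity L f) (Icc (-π) π) :=
  (integrableOn_filteredDensity hf).div_const _

theorem integral_normalizedFilteredDensity (hL : L ≠ ⊤) (hf : IsNormalizedSpectralDensity f) :
    ∫ ν in Icc (-π) π, normalizedFilteredDensity L f ν = 1 := by
  simp only [normalizedFilteredDensity]
  rw [integral_div, div_self (integral_filteredDensity_pos hL hf).ne']

theorem normalizedFilteredDensity_neg (hf : IsNormalizedSpectralDensity f) {ν : ℝ}
    (hν : ν ∈ Icc (-π) π) :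
    normalizedFilteredDensity L f (-ν) = normalizedFilteredDensity L f ν := by
  simp only [normalizedFilteredDensity, filteredDensity_eq, polyNormSq_map_neg, hf.even ν hν]

theorem integral_spectralMeasure {g : ℝ → ℝ} (hg : IntegrableOn g (Icc (-π) π))
    (hnn : ∀ ν ∈ Icc (-π) π, 0 ≤ g ν) (φ : ℝ → ℝ) :
    ∫ ν, φ ν ∂spectralMeasure g = ∫ ν in Icc (-π) π, g ν * φ ν := by
  rw [spectralMeasure, integral_withDensity_eq_integral_toReal_smul₀
    hg.aestronglyMeasurable.aemeasurable.ennreal_ofReal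
    (Eventually.of_forall fun _ => ENNReal.ofReal_lt_top)]
  refine setIntegral_congr_fun measurableSet_Icc fun ν hν => ?_
  simp only [ENNReal.toReal_ofReal (hnn ν hν), smul_eq_mul]

theorem isProbabilityMeasure_spectralMeasure {g : ℝ → ℝ} (hg : IntegrableOn g (Icc (-π) π))
    (hnn : ∀ ν ∈ Icc (-π) π, 0 ≤ g ν) (h1 : ∫ ν in Icc (-π) π, g ν = 1) :
    IsProbabilityMeasure (spectralMeasure g) := by
  constructor
  rw [spectralMeasure, withDensity_apply _ MeasurableSet.univ, Measure.restrict_univ,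
    ← ofReal_integral_eq_lintegral_ofReal hg
      ((ae_restrict_mem measurableSet_Icc).mono fun ν hν => hnn ν hν), h1, ENNReal.ofReal_one]

theorem spectralMeasure_compl (g : ℝ → ℝ) : spectralMeasure g (Icc (-π) π)ᶜ = 0 := by
  refine withDensity_absolutelyContinuous _ _ ?_
  rw [Measure.restrict_apply measurableSet_Icc.compl]; simp

/-- The factor `|Δ|²` in `|p_v|²` is moved into the density. After division by its total mass, the
quadratic form depends on `f` only through a probability measure. -/
theorem dotProduct_covMatrix_eq_integral_spectralMeasure (hL : L ≠ ⊤)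
    (hf : IsNormalizedSpectralDensity f) {v : EuclideanSpace ℝ (Fin n)} {w : Polynomial ℂ}
    (hw : coeffPoly v = (diffPolyOf L).map (algebraMap ℝ ℂ) * w) :
    v.ofLp ⬝ᵥ (covMatrix n f *ᵥ v.ofLp) =
      (∫ ν in Icc (-π) π, filteredDensity L f ν) *
        ∫ ν, polyNormSq w ν ∂spectralMeasure (normalizedFilteredDensity L f) := by
  have hpos := integral_filteredDensity_pos hL hf
  rw [dotProduct_covMatrix_mulVec hf.integrable,
    integral_spectralMeasure (integrableOn_normalizedFilteredDensity hf)
      (fun ν hν => normalizedFilteredDensity_nonneg hf hν), ← integral_const_mul]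
  refine integral_congr_ae (Eventually.of_forall fun ν => ?_)
  simp only [normalizedFilteredDensity]
  rw [hw, polyNormSq_mul, filteredDensity_eq L f ν]
  field_simp

/-! ### Weak limits -/

theorem exists_weak_limit (hL : L ≠ ⊤) {f : ℕ → ℝ → ℝ}
    (hf : ∀ j, IsNormalizedSpectralDensity (f j)) :
    ∃ m : Measure ℝ, IsProbabilityMeasure m ∧ m (Icc (-π) π)ᶜ = 0 ∧
      ∃ φ : ℕ → ℕ, StrictMono φ ∧ ∀ h : BoundedContinuousFunction ℝ ℝ,
        Tendsto (fun j => ∫ ν, h ν ∂spectralMeasure (normalizedFilteredDensity L (f (φ j)))) atTop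
          (𝓝 (∫ ν, h ν ∂m)) := by
  let P : ℕ → ProbabilityMeasure ℝ := fun j =>
    ⟨spectralMeasure (normalizedFilteredDensity L (f j)),
      isProbabilityMeasure_spectralMeasure (integrableOn_normalizedFilteredDensity (hf j))
        (fun ν hν => normalizedFilteredDensity_nonneg (hf j) hν)
        (integral_normalizedFilteredDensity hL (hf j))⟩
  -- Prokhorov compactness: all the measures live on the compact set `[-π, π]`, so the tightness
  -- bound can be taken to be zero.
  have hK := isCompact_setOfPred_probabilityMeasure_mass_eq_compl_isCompact_le (E := ℝ)
    (u := fun _ => 0) (K := fun _ => Icc (-π) π) tendsto_const_nhds (fun _ => isCompact_Icc)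
    (Or.inl inferInstance)
  have hP : ∀ j, P j ∈ {μ : ProbabilityMeasure ℝ | ∀ _ : ℕ, μ (Icc (-π) π)ᶜ ≤ 0} := fun j _ => by
    rw [← ENNReal.coe_le_coe, ProbabilityMeasure.ennreal_coeFn_eq_coeFn_toMeasure]
    exact (spectralMeasure_compl _).le
  obtain ⟨m, hm, φ, hφ, hlim⟩ := hK.tendsto_subseq hP
  refine ⟨m, inferInstance, ?_, φ, hφ, ?_⟩
  · have := hm 0
    rw [← ENNReal.coe_le_coe, ProbabilityMeasure.ennreal_coeFn_eq_coeFn_toMeasure] at this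
    exact le_antisymm this zero_le
  · exact ProbabilityMeasure.tendsto_iff_forall_integral_tendsto.1 hlim

theorem map_neg_eq_of_weak_limit {f : ℕ → ℝ → ℝ} (hf : ∀ j, IsNormalizedSpectralDensity (f j))
    {m : Measure ℝ} [IsFiniteMeasure m]
    (hm : ∀ h : BoundedContinuousFunction ℝ ℝ,
      Tendsto (fun j => ∫ ν, h ν ∂spectralMeasure (normalizedFilteredDensity L (f j))) atTop
        (𝓝 (∫ ν, h ν ∂m))) : m.map (fun ν => -ν) = m := by
  refine ext_of_forall_integral_eq_of_IsFiniteMeasure fun h => ?_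
  rw [integral_map (by fun_prop) h.continuous.aestronglyMeasurable]
  refine tendsto_nhds_unique (hm (h.compContinuous ⟨fun ν => -ν, by fun_prop⟩)) ?_
  convert hm h using 2 with j
  rw [integral_spectralMeasure (integrableOn_normalizedFilteredDensity (hf j))
      (fun ν hν => normalizedFilteredDensity_nonneg (hf j) hν),
    integral_spectralMeasure (integrableOn_normalizedFilteredDensity (hf j))
      (fun ν hν => normalizedFilteredDensity_nonneg (hf j) hν),
    ← setIntegral_Icc_comp_neg fun ν => normalizedFilteredDensity L (f j) ν * h ν]
  refine setIntegral_congr_fun measurableSet_Icc fun ν hν => ?_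
  simp only [normalizedFilteredDensity_neg (hf j) hν]
  rfl

theorem measure_neg_preimage {m : Measure ℝ} (hm : m.map (fun ν => -ν) = m) {A : Set ℝ}
    (hA : MeasurableSet A) : m {ν | -ν ∈ A} = m A := by
  conv_rhs => rw [← hm, Measure.map_apply measurable_neg hA]
  rfl

theorem neg_mem_support {m : Measure ℝ}
    (hsymm : ∀ A : Set ℝ, MeasurableSet A → m {ν | -ν ∈ A} = m A) {x : ℝ} (hx : x ∈ m.support) :
    -x ∈ m.support := by
  by_contra hc
  obtain ⟨U, hU, h0⟩ := Measure.notMem_support_iff_exists.1 hc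
  obtain ⟨V, hVU, hV, hxV⟩ := mem_nhds_iff.1 hU
  have h1 : m {ν | -ν ∈ V} = 0 := by
    rw [hsymm V hV.measurableSet]; exact measure_mono_null hVU h0
  exact ((Measure.mem_support_iff_forall x).1 hx _
    ((hV.preimage continuous_neg).mem_nhds hxV)).ne' h1

theorem support_subset_Icc {m : Measure ℝ} (hm : m (Icc (-π) π)ᶜ = 0) :
    m.support ⊆ Icc (-π) π :=
  Measure.support_subset_of_isClosed isClosed_Icc hm

/-- A nonnegative continuous function that vanishes almost everywhere vanishes on the support, and
the support has full measure. -/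
theorem integral_polyNormSq_eq_zero_iff {m : Measure ℝ} [IsFiniteMeasure m] (w : Polynomial ℂ) :
    ∫ ν, polyNormSq w ν ∂m = 0 ↔
      ∀ γ ∈ m.support, w.eval (Complex.exp (Complex.I * γ)) = 0 := by
  rw [integral_eq_zero_iff_of_nonneg (fun ν => polyNormSq_nonneg w ν)
    ((polyNormSq w).integrable m)]
  simp only [← polyNormSq_eq_zero_iff]
  constructor
  · intro h γ hγ
    by_contra hc
    have hopen : IsOpen {ν | polyNormSq w ν ≠ 0} := isOpen_ne.preimage (polyNormSq w).continuous
    exact Measure.subset_compl_support_of_isOpen hopen (ae_iff.1 h) hc hγ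
  · intro h
    filter_upwards [Measure.support_mem_ae (μ := m)] with γ hγ using h γ hγ

/-- In terms of the frequencies in `[0, π]`, when the measure is symmetric. -/
theorem integral_polyNormSq_eq_zero_iff_of_symm {m : Measure ℝ} [IsFiniteMeasure m]
    (hsymm : ∀ A : Set ℝ, MeasurableSet A → m {ν | -ν ∈ A} = m A) (hm : m (Icc (-π) π)ᶜ = 0)
    (w : Polynomial ℂ) :
    ∫ ν, polyNormSq w ν ∂m = 0 ↔
      ∀ γ ∈ m.support ∩ Icc 0 π, ∀ z ∈ diffRoots γ, w.eval z = 0 := by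
  rw [integral_polyNormSq_eq_zero_iff]
  constructor
  · rintro h γ ⟨hγ, -⟩ z hz
    simp only [diffRoots, Finset.mem_insert, Finset.mem_singleton] at hz
    rcases hz with rfl | rfl
    · exact h γ hγ
    · simpa using h (-γ) (neg_mem_support hsymm hγ)
  · intro h γ hγ
    have hI := support_subset_Icc hm hγ
    rcases le_total 0 γ with h0 | h0
    · exact h γ ⟨hγ, h0, hI.2⟩ _ (exp_mem_diffRoots γ)
    · refine h (-γ) ⟨neg_mem_support hsymm hγ, by linarith, by linarith [hI.1]⟩ _ ?_
      simp [diffRoots]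

theorem finite_support_of_zeros {m : Measure ℝ} (hm : m (Icc (-π) π)ᶜ = 0) {w : Polynomial ℂ}
    (hw : w ≠ 0) (h : ∀ γ ∈ m.support, w.eval (Complex.exp (Complex.I * γ)) = 0) :
    m.support.Finite :=
  (finite_zeros_on_circle hw).subset fun γ hγ => ⟨support_subset_Icc hm hγ, h γ hγ⟩

/-- A nonzero polynomial that vanishes at all `e^{± i γ}`, `γ ∈ Γ`, has degree at least
`∑ κ(γ)`. -/
theorem sum_kappa_le_natDegree {Γ : Set ℝ} (hΓ : Γ ⊆ Icc 0 π) (hfin : Γ.Finite)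
    {w : Polynomial ℂ} (hw : w ≠ 0) (h : ∀ γ ∈ Γ, ∀ z ∈ diffRoots γ, w.eval z = 0) :
    ∑ᶠ γ ∈ Γ, kappa γ 1 ≤ w.natDegree := by
  classical
  rw [finsum_mem_eq_finite_toFinset_sum _ hfin]
  have hmem : ∀ γ ∈ hfin.toFinset, γ ∈ Γ := fun γ hγ => hfin.mem_toFinset.1 hγ
  rw [Finset.sum_congr rfl fun γ hγ => (card_diffRoots (hΓ (hmem γ hγ))).symm,
    ← Finset.card_biUnion]
  · refine Polynomial.card_le_degree_of_subset_roots fun z hz => ?_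
    obtain ⟨γ, hγ, hz⟩ := Finset.mem_biUnion.1 hz
    exact (Polynomial.mem_roots hw).2 (h γ (hmem γ hγ) z hz)
  · intro γ hγ γ' hγ' hne
    rw [Function.onFun, Finset.disjoint_left]
    exact fun z hz hz' => hne (disjoint_diffRoots (hΓ (hmem γ hγ)) (hΓ (hmem γ' hγ')) hz hz')

end SpectralDensities

/-! ### Existence of critical values -/

section CriticalValues

open scoped MatrixOrder

variable {n k q : ℕ}

theorem nullMeansLin_ne_top (hkn : k < n) (X : Matrix (Fin n) (Fin k) ℝ)
    (R : Matrix (Fin q) (Fin k) ℝ) : nullMeansLin X R ≠ ⊤ := by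
  intro h
  let g : (Fin k → ℝ) →ₗ[ℝ] EuclideanSpace ℝ (Fin n) :=
    (WithLp.linearEquiv 2 ℝ (Fin n → ℝ)).symm.toLinearMap ∘ₗ X.mulVecLin
  have h1 : nullMeansLin X R ≤ LinearMap.range g := by
    rintro _ ⟨β, rfl, -⟩
    exact ⟨β, rfl⟩
  have h2 := Submodule.finrank_mono h1
  have h3 := LinearMap.finrank_range_le g
  rw [h, finrank_top, finrank_euclideanSpace_fin] at h2
  rw [Module.finrank_fin_fun] at h3
  omega

/-! ### The square roots of the covariance matrices -/

theorem isSelfAdjoint_sqrtCLM (S : Matrix (Fin n) (Fin n) ℝ) :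
    IsSelfAdjoint (Matrix.toEuclideanCLM (𝕜 := ℝ) (CFC.sqrt S)) :=
  (CFC.sqrt_nonneg S).isSelfAdjoint.map _

theorem norm_sqrtCLM_sq {S : Matrix (Fin n) (Fin n) ℝ} (hS : S.PosSemidef)
    (v : EuclideanSpace ℝ (Fin n)) :
    ‖Matrix.toEuclideanCLM (𝕜 := ℝ) (CFC.sqrt S) v‖ ^ 2 = v.ofLp ⬝ᵥ (S *ᵥ v.ofLp) := by
  rw [← real_inner_self_eq_norm_sq]
  conv_lhs => enter [2]; rw [← (isSelfAdjoint_sqrtCLM S).adjoint_eq]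
  rw [ContinuousLinearMap.adjoint_inner_left, ← ContinuousLinearMap.comp_apply,
    ← ContinuousLinearMap.mul_def, ← map_mul, CFC.sqrt_mul_sqrt_self _ hS.nonneg,
    Matrix.inner_toEuclideanCLM]

/-- The square root of `S`, followed by the projection onto `Lᗮ` and normalization by `√c`. -/
noncomputable def projSqrt (L : Submodule ℝ (EuclideanSpace ℝ (Fin n))) (c : ℝ)
    (S : Matrix (Fin n) (Fin n) ℝ) : EuclideanSpace ℝ (Fin n) →L[ℝ] EuclideanSpace ℝ (Fin n) :=
  (√c)⁻¹ • (Lᗮ.starProjection ∘L Matrix.toEuclideanCLM (𝕜 := ℝ) (CFC.sqrt S))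

theorem adjoint_projSqrt_apply (L : Submodule ℝ (EuclideanSpace ℝ (Fin n))) (c : ℝ)
    (S : Matrix (Fin n) (Fin n) ℝ) (v : EuclideanSpace ℝ (Fin n)) :
    ContinuousLinearMap.adjoint (projSqrt L c S) v =
      (√c)⁻¹ • Matrix.toEuclideanCLM (𝕜 := ℝ) (CFC.sqrt S) (Lᗮ.starProjection v) := by
  have h1 : ContinuousLinearMap.adjoint Lᗮ.starProjection = Lᗮ.starProjection :=
    (isSelfAdjoint_starProjection Lᗮ).adjoint_eq
  rw [projSqrt, map_smulₛₗ, ContinuousLinearMap.adjoint_comp, (isSelfAdjoint_sqrtCLM S).adjoint_eq,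
    h1]
  simp

theorem norm_adjoint_projSqrt_sq (L : Submodule ℝ (EuclideanSpace ℝ (Fin n))) {c : ℝ} (hc : 0 ≤ c)
    {S : Matrix (Fin n) (Fin n) ℝ} (hS : S.PosSemidef) {v : EuclideanSpace ℝ (Fin n)}
    (hv : v ∈ Lᗮ) :
    ‖ContinuousLinearMap.adjoint (projSqrt L c S) v‖ ^ 2 =
      c⁻¹ * (v.ofLp ⬝ᵥ (S *ᵥ v.ofLp)) := by
  rw [adjoint_projSqrt_apply, norm_smul, mul_pow, Submodule.starProjection_eq_self_iff.2 hv,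
    norm_sqrtCLM_sq hS]
  congr 1
  rw [norm_inv, inv_pow, Real.norm_eq_abs, sq_abs, Real.sq_sqrt hc]

/-- The rejection probability under the null hypothesis, in terms of a standard normal vector. -/
theorem EstimatorAssumption.multivariateGaussian_le_fTypeStat {X : Matrix (Fin n) (Fin k) ℝ}
    {N : Set (EuclideanSpace ℝ (Fin n))} {βc : EuclideanSpace ℝ (Fin n) → Fin k → ℝ}
    {Ωc : EuclideanSpace ℝ (Fin n) → Matrix (Fin q) (Fin q) ℝ}
    (h : EstimatorAssumption X N βc Ωc) {R : Matrix (Fin q) (Fin k) ℝ} {r : Fin q → ℝ}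
    {μ : EuclideanSpace ℝ (Fin n)} (hμ : μ ∈ nullMeans X R r) (S : Matrix (Fin n) (Fin n) ℝ)
    {c : ℝ} (hc : 0 < c) (C : ℝ) :
    multivariateGaussian μ S {y | C ≤ fTypeStat R r N βc Ωc y} =
      stdGaussian (EuclideanSpace ℝ (Fin n))
        {x | C ≤ fTypeStat R 0 N βc Ωc (projSqrt (nullMeansLin X R) c S x)} := by
  rw [multivariateGaussian, Measure.map_apply (by fun_prop)
    (measurableSet_le measurable_const (h.measurable_fTypeStat R r))]
  congr 1
  ext x
  simp only [mem_preimage, mem_ofPred_eq]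
  set L := nullMeansLin X R
  set a := Matrix.toEuclideanCLM (𝕜 := ℝ) (CFC.sqrt S) x with ha
  -- The component of the Gaussian vector in `L` is absorbed into the mean, which stays in the null
  -- hypothesis.
  have h1 : μ + (a - Lᗮ.starProjection a) ∈ nullMeans X R r := by
    rw [← sub_mem_nullMeansLin_iff X R r hμ, add_sub_cancel_left]
    have := Submodule.sub_starProjection_mem_orthogonal (K := Lᗮ) a
    rwa [Submodule.orthogonal_orthogonal] at this
  obtain ⟨η, hη, hr⟩ := h1
  have hc' : √c ≠ 0 := (Real.sqrt_pos.2 hc).ne'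
  have h2 : μ + a = √c • projSqrt L c S x + meanVec X η := by
    rw [← hη, projSqrt]
    simp only [smul_apply, ContinuousLinearMap.comp_apply, ← ha, smul_smul,
      mul_inv_cancel₀ hc', one_smul]
    abel
  rw [h2, h.fTypeStat_smul_add _ hc' hr]

/-! ### The limiting covariance matrices -/

section Limit

variable {L : Submodule ℝ (EuclideanSpace ℝ (Fin n))}
  {B : EuclideanSpace ℝ (Fin n) →L[ℝ] EuclideanSpace ℝ (Fin n)} {m : Measure ℝ}

theorem mem_orthogonal_range_iff (v : EuclideanSpace ℝ (Fin n)) :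
    v ∈ (LinearMap.range B.toLinearMap)ᗮ ↔ ContinuousLinearMap.adjoint B v = 0 := by
  rw [ContinuousLinearMap.orthogonal_range]
  rfl

theorem mem_orthogonal_jointSpan_iff (Γ : Set ℝ) (v : EuclideanSpace ℝ (Fin n)) :
    v ∈ (jointSpan L Γ)ᗮ ↔ ∀ γ ∈ Γ, v ∈ (trigSpan n (rho γ L) γ)ᗮ := by
  rw [jointSpan, ← Submodule.iInf_orthogonal, Submodule.mem_iInf]
  refine forall_congr' fun γ => ?_
  by_cases hγ : γ ∈ Γ <;> simp [hγ]

/-- The range of a limiting covariance matrix, modulo `L`, is given by the support of the limiting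
spectral measure. -/
theorem range_sup_eq_jointSpan_sup [IsFiniteMeasure m] (hL : L ≠ ⊤)
    (hsymm : ∀ A : Set ℝ, MeasurableSet A → m {ν | -ν ∈ A} = m A) (hm : m (Icc (-π) π)ᶜ = 0)
    (hB : ∀ v ∈ Lᗮ, ∀ w, coeffPoly v = (diffPolyOf L).map (algebraMap ℝ ℂ) * w →
      ‖ContinuousLinearMap.adjoint B v‖ ^ 2 = ∫ ν, polyNormSq w ν ∂m) :
    LinearMap.range B.toLinearMap ⊔ L = jointSpan L (m.support ∩ Icc 0 π) ⊔ L := by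
  -- The two spaces are compared through their orthogonal complements, where only vectors of `Lᗮ`
  -- occur and the formula `hB` applies.
  rw [← Submodule.orthogonal_orthogonal (LinearMap.range B.toLinearMap ⊔ L),
    ← Submodule.orthogonal_orthogonal (jointSpan L (m.support ∩ Icc 0 π) ⊔ L)]
  congr 1
  rw [← Submodule.inf_orthogonal, ← Submodule.inf_orthogonal]
  ext v
  simp only [Submodule.mem_inf, and_congr_left_iff]
  intro hv
  obtain ⟨w, hw⟩ := diffPolyOf_map_dvd_coeffPoly hL hv
  rw [mem_orthogonal_range_iff, mem_orthogonal_jointSpan_iff, ← norm_eq_zero,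
    ← sq_eq_zero_iff, hB v hv w hw, integral_polyNormSq_eq_zero_iff_of_symm hsymm hm]
  refine forall₂_congr fun γ hγ => ?_
  constructor
  · intro h
    exact (eval_quotient_eq_zero_iff hL hv hw hγ.2 (exp_mem_diffRoots γ)).1
      (h _ (exp_mem_diffRoots γ))
  · exact fun h z hz => (eval_quotient_eq_zero_iff hL hv hw hγ.2 hz).2 h

/-- If the support of the limiting spectral measure is too large, the limiting covariance matrix is
nonsingular modulo `L`. -/
theorem range_sup_eq_top [IsFiniteMeasure m] (hL : L ≠ ⊤)
    (hsymm : ∀ A : Set ℝ, MeasurableSet A → m {ν | -ν ∈ A} = m A) (hm : m (Icc (-π) π)ᶜ = 0)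
    (hB : ∀ v ∈ Lᗮ, ∀ w, coeffPoly v = (diffPolyOf L).map (algebraMap ℝ ℂ) * w →
      ‖ContinuousLinearMap.adjoint B v‖ ^ 2 = ∫ ν, polyNormSq w ν ∂m)
    (hcount : ¬ (m.support.Finite ∧
      (∑ᶠ γ ∈ m.support ∩ Icc 0 π, kappa γ 1) + kappaOf L < n)) :
    LinearMap.range B.toLinearMap ⊔ L = ⊤ := by
  rw [← Submodule.orthogonal_eq_bot_iff, ← Submodule.inf_orthogonal, eq_bot_iff]
  rintro v ⟨hvB, hv⟩
  rw [Submodule.mem_bot]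
  by_contra hv0
  obtain ⟨w, hw⟩ := diffPolyOf_map_dvd_coeffPoly hL hv
  have hp0 : coeffPoly v ≠ 0 := (coeffPoly_eq_zero_iff v).not.2 hv0
  have hw0 : w ≠ 0 := by
    rintro rfl
    exact hp0 (by rw [hw, mul_zero])
  have h0 : ∫ ν, polyNormSq w ν ∂m = 0 := by
    rw [← hB v hv w hw, (mem_orthogonal_range_iff v).1 hvB]
    simp
  have hfin := finite_support_of_zeros hm hw0 ((integral_polyNormSq_eq_zero_iff w).1 h0)
  refine hcount ⟨hfin, ?_⟩
  have h1 := sum_kappa_le_natDegree inter_subset_right (hfin.inter_of_left (Icc 0 π)) hw0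
    ((integral_polyNormSq_eq_zero_iff_of_symm hsymm hm w).1 h0)
  -- `κ̄ + deg w = deg p_v < n`, while `deg w` is at least the number of zeros forced by the
  -- support.
  have h2 := natDegree_coeffPoly_lt hv0
  rw [hw, Polynomial.natDegree_mul (diffPolyOf_map_ne_zero hL) hw0,
    natDegree_diffPolyOf_map hL] at h2
  omega

end Limit

/-- A sequence of operators whose adjoints are pointwise bounded has a convergent subsequence. -/
theorem exists_tendsto_subseq_of_adjoint_bounded
    (B : ℕ → EuclideanSpace ℝ (Fin n) →L[ℝ] EuclideanSpace ℝ (Fin n))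
    (h : ∀ v, ∃ C, ∀ j, ‖ContinuousLinearMap.adjoint (B j) v‖ ≤ C) :
    ∃ (A : EuclideanSpace ℝ (Fin n) →L[ℝ] EuclideanSpace ℝ (Fin n)) (φ : ℕ → ℕ),
      StrictMono φ ∧ Tendsto (fun j => B (φ j)) atTop (𝓝 A) := by
  -- Taking adjoints is isometric, so a uniform bound on the adjoints bounds the operators, and the
  -- operator space is finite-dimensional.
  obtain ⟨C, hC⟩ := banach_steinhaus h
  have : ProperSpace (EuclideanSpace ℝ (Fin n) →L[ℝ] EuclideanSpace ℝ (Fin n)) :=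
    FiniteDimensional.proper ℝ _
  have hmem : ∀ j, B j ∈ Metric.closedBall
      (0 : EuclideanSpace ℝ (Fin n) →L[ℝ] EuclideanSpace ℝ (Fin n)) C := fun j => by
    rw [mem_closedBall_zero_iff, ← LinearIsometryEquiv.norm_map ContinuousLinearMap.adjoint (B j)]
    exact hC j
  obtain ⟨A, -, φ, hφ, hlim⟩ := tendsto_subseq_of_bounded Metric.isBounded_closedBall hmem
  exact ⟨A, φ, hφ, hlim⟩

/-- If `T` is continuous off the closed set `N` and `B x ∉ N` for almost all `x`, then
`T (B_j x)`, with `B_j → B`, exceeds levels tending to infinity with vanishing probability. -/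
theorem tendsto_measure_le_of_tendsto {E F : Type*} [NormedAddCommGroup E] [NormedSpace ℝ E]
    [MeasurableSpace E] [BorelSpace E] [NormedAddCommGroup F] [NormedSpace ℝ F]
    [MeasurableSpace F] [BorelSpace F] {P : Measure E} [IsFiniteMeasure P]
    {T : F → ℝ} {N : Set F} (hN : IsClosed N) (hT : ContinuousOn T Nᶜ) (hTm : Measurable T)
    {B : ℕ → E →L[ℝ] F} {A : E →L[ℝ] F} (hB : Tendsto B atTop (𝓝 A))
    (hA : ∀ᵐ x ∂P, A x ∉ N) {c : ℕ → ℝ} (hc : Tendsto c atTop atTop) :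
    Tendsto (fun j => P {x | c j ≤ T (B j x)}) atTop (𝓝 0) := by
  rw [← measure_empty (μ := P)]
  refine tendsto_measure_of_ae_tendsto_indicator_of_isFiniteMeasure (L := atTop)
    MeasurableSet.empty
    (fun j => measurableSet_le measurable_const (hTm.comp (B j).continuous.measurable)) ?_
  filter_upwards [hA] with x hx
  have h1 : Tendsto (fun j => B j x) atTop (𝓝 (A x)) :=
    ((ContinuousLinearMap.apply ℝ F x).continuous.tendsto A).comp hB
  have h2 : Tendsto (fun j => T (B j x)) atTop (𝓝 (T (A x))) :=
    (hT.continuousAt (hN.isOpen_compl.mem_nhds hx)).tendsto.comp h1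
  filter_upwards [h2.eventually_lt_const (lt_add_one (T (A x))),
    hc.eventually_ge_atTop (T (A x) + 1)] with j h3 h4
  simp only [mem_empty_iff_false, iff_false, not_le]
  exact h3.trans_le h4

theorem isLimitMeasure_of_weak_limit {L : Submodule ℝ (EuclideanSpace ℝ (Fin n))}
    {F : Set (ℝ → ℝ)} {m : Measure ℝ} [IsFiniteMeasure m]
    (hm : m (Icc (-π) π)ᶜ = 0)
    (hsymm : ∀ A : Set ℝ, MeasurableSet A → m {ν | -ν ∈ A} = m A) {f : ℕ → ℝ → ℝ}
    (hf : ∀ j, f j ∈ F)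
    (hlim : ∀ h : BoundedContinuousFunction ℝ ℝ,
      Tendsto (fun j => ∫ ν, h ν ∂spectralMeasure (normalizedFilteredDensity L (f j))) atTop
        (𝓝 (∫ ν, h ν ∂m)))
    (hfin : m.support.Finite)
    (hcount : (∑ᶠ γ ∈ m.support ∩ Icc 0 π, kappa γ 1) + kappaOf L < n) : IsLimitMeasure F L m :=
  ⟨inferInstance, hm, hsymm, hfin, ⟨f, hf, hlim⟩, hcount⟩

/-- Size control: a critical value exists if `N*` is null for every limiting space. -/
theorem EstimatorAssumption.exists_critical_value (hkn : k < n) {X : Matrix (Fin n) (Fin k) ℝ}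
    {N : Set (EuclideanSpace ℝ (Fin n))} {βc : EuclideanSpace ℝ (Fin n) → Fin k → ℝ}
    {Ωc : EuclideanSpace ℝ (Fin n) → Matrix (Fin q) (Fin q) ℝ}
    (h : EstimatorAssumption X N βc Ωc) (R : Matrix (Fin q) (Fin k) ℝ) (r : Fin q → ℝ)
    {F : Set (ℝ → ℝ)} (hF : ∀ f ∈ F, IsNormalizedSpectralDensity f)
    (hnull : ∀ Γ ∈ limitSupports F (nullMeansLin X R),
      lebesgueOn (jointSpan (nullMeansLin X R) Γ) (nStar N Ωc) = 0) {α : ℝ} (hα : 0 < α) :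
    ∃ C : ℝ, testSize X R r F {y | C ≤ fTypeStat R r N βc Ωc y} ≤ ENNReal.ofReal α := by
  by_contra hcon
  push Not at hcon
  have hL := nullMeansLin_ne_top hkn X R
  set L := nullMeansLin X R with hLdef
  have hex : ∀ j : ℕ, ∃ μ ∈ nullMeans X R r, ∃ s : ℝ, 0 < s ∧ ∃ f ∈ F, ENNReal.ofReal α <
      multivariateGaussian μ (s • covMatrix n f) {y | (j : ℝ) ≤ fTypeStat R r N βc Ωc y} := by
    intro j
    have := hcon j
    simp only [testSize, lt_iSup_iff] at this
    obtain ⟨μ, hμ, s, hs, f, hf, hlt⟩ := this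
    exact ⟨μ, hμ, s, hs, f, hf, hlt⟩
  choose μ hμ s hs f hfF hlt using hex
  have hf : ∀ j, IsNormalizedSpectralDensity (f j) := fun j => hF _ (hfF j)
  let I : ℕ → ℝ := fun j => ∫ ν in Icc (-π) π, filteredDensity L (f j) ν
  have hI : ∀ j, 0 < I j := fun j => integral_filteredDensity_pos hL (hf j)
  -- The scale `s j * I j` cancels the variance and the mass of the filtered density.
  let B : ℕ → EuclideanSpace ℝ (Fin n) →L[ℝ] EuclideanSpace ℝ (Fin n) := fun j =>
    projSqrt L (s j * I j) (s j • covMatrix n (f j))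
  have hprob : ∀ j : ℕ, ENNReal.ofReal α <
      stdGaussian (EuclideanSpace ℝ (Fin n)) {x | (j : ℝ) ≤ fTypeStat R 0 N βc Ωc (B j x)} :=
    fun j => by
      rw [← h.multivariateGaussian_le_fTypeStat (hμ j) _ (mul_pos (hs j) (hI j))]
      exact hlt j
  have hnorm : ∀ j, ∀ v ∈ Lᗮ, ∀ w, coeffPoly v = (diffPolyOf L).map (algebraMap ℝ ℂ) * w →
      ‖ContinuousLinearMap.adjoint (B j) v‖ ^ 2 =
        ∫ ν, polyNormSq w ν ∂spectralMeasure (normalizedFilteredDensity L (f j)) := by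
    intro j v hv w hw
    rw [norm_adjoint_projSqrt_sq L (mul_pos (hs j) (hI j)).le
      ((posSemidef_covMatrix (hf j)).smul (hs j).le) hv, Matrix.smul_mulVec, dotProduct_smul,
      dotProduct_covMatrix_eq_integral_spectralMeasure hL (hf j) hw, smul_eq_mul]
    have h1 := (hs j).ne'
    have h2 := (hI j).ne'
    change (s j * I j)⁻¹ * (s j * (I j * _)) = _
    field_simp
  obtain ⟨m, hmP, hmc, φ, hφ, hmlim⟩ := exists_weak_limit hL hf
  have hsymm : ∀ A : Set ℝ, MeasurableSet A → m {ν | -ν ∈ A} = m A := fun A hA =>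
    measure_neg_preimage (map_neg_eq_of_weak_limit (fun j => hf (φ j)) hmlim) hA
  obtain ⟨A, ψ, hψ, hA⟩ := exists_tendsto_subseq_of_adjoint_bounded (fun j => B (φ j)) (by
    intro v
    obtain ⟨w, hw⟩ := diffPolyOf_map_dvd_coeffPoly hL (Lᗮ.starProjection_apply_mem v)
    -- The supremum of `|w|²` on the circle bounds its integral against any of the probability
    -- measures, uniformly in `j`.
    refine ⟨√‖polyNormSq w‖, fun j => Real.le_sqrt_of_sq_le ?_⟩
    have : IsProbabilityMeasure
        (spectralMeasure (normalizedFilteredDensity L (f (φ j)))) :=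
      isProbabilityMeasure_spectralMeasure (integrableOn_normalizedFilteredDensity (hf _))
        (fun ν hν => normalizedFilteredDensity_nonneg (hf _) hν)
        (integral_normalizedFilteredDensity hL (hf _))
    have h1 : ContinuousLinearMap.adjoint (B (φ j)) v =
        ContinuousLinearMap.adjoint (B (φ j)) (Lᗮ.starProjection v) := by
      rw [adjoint_projSqrt_apply, adjoint_projSqrt_apply, Submodule.starProjection_eq_self_iff.2
        (Lᗮ.starProjection_apply_mem v)]
    rw [h1, hnorm _ _ (Lᗮ.starProjection_apply_mem v) w hw]
    refine (Real.le_norm_self _).trans ?_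
    exact (polyNormSq w).norm_integral_le_norm _)
  have hAnorm : ∀ v ∈ Lᗮ, ∀ w, coeffPoly v = (diffPolyOf L).map (algebraMap ℝ ℂ) * w →
      ‖ContinuousLinearMap.adjoint A v‖ ^ 2 = ∫ ν, polyNormSq w ν ∂m := by
    intro v hv w hw
    refine tendsto_nhds_unique (f := fun j =>
      ‖ContinuousLinearMap.adjoint (B (φ (ψ j))) v‖ ^ 2) (l := atTop) ?_ ?_
    · have h1 : Tendsto (fun j => ContinuousLinearMap.adjoint (B (φ (ψ j)))) atTop
          (𝓝 (ContinuousLinearMap.adjoint A)) :=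
        (ContinuousLinearMap.adjoint.continuous.tendsto A).comp hA
      exact ((((ContinuousLinearMap.apply ℝ _ v).continuous.tendsto _).comp h1).norm).pow 2
    · simp only [hnorm _ v hv w hw]
      exact (hmlim (polyNormSq w)).comp hψ.tendsto_atTop
  have hmeas : MeasurableSet (nStar N Ωc) := h.isClosed_nStar.measurableSet
  have hinv := h.add_mem_nStar_iff R
  -- If the counting condition holds, the support belongs to `𝕊` and the hypothesis on `𝒯_Γ`
  -- applies. Otherwise `A` is onto modulo `L`, and it suffices that `N*` is Lebesgue-null.
  have hae : ∀ᵐ x, A x ∉ nStar N Ωc := by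
    by_cases hcount : m.support.Finite ∧
      (∑ᶠ γ ∈ m.support ∩ Icc 0 π, kappa γ 1) + kappaOf L < n
    · have hΓ : m.support ∩ Icc 0 π ∈ limitSupports F L :=
        ⟨m, isLimitMeasure_of_weak_limit hmc hsymm (fun j => hfF (φ j)) hmlim hcount.1 hcount.2,
          rfl⟩
      have h0 := (lebesgueOn_eq_zero_iff _ hmeas).1 (hnull _ hΓ)
      refine (ae_notMem_iff_of_range_sup_eq volume
        (stdOrthonormalBasis ℝ (jointSpan L (m.support ∩ Icc 0 π))).toBasis.addHaar
        A.toLinearMap (jointSpan L (m.support ∩ Icc 0 π)).subtype L ?_ hmeas hinv).2 h0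
      rw [range_sup_eq_jointSpan_sup hL hsymm hmc hAnorm, Submodule.range_subtype]
    · refine (ae_notMem_iff_of_range_sup_eq volume volume A.toLinearMap LinearMap.id L ?_
        hmeas hinv).2 h.ae_notMem_nStar
      rw [range_sup_eq_top hL hsymm hmc hAnorm hcount, LinearMap.range_id, top_sup_eq]
  have hφψ := (hφ.comp hψ).tendsto_atTop
  have hlim := tendsto_measure_le_of_tendsto (P := stdGaussian (EuclideanSpace ℝ (Fin n)))
    h.isClosed_nStar (h.continuousOn_fTypeStat R 0) (h.measurable_fTypeStat R 0) hA
    (stdGaussian_absolutelyContinuous.ae_le hae)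
    (c := fun j => ((φ (ψ j) : ℕ) : ℝ)) (tendsto_natCast_atTop_atTop.comp hφψ)
  obtain ⟨j, hj⟩ := (hlim.eventually_lt_const (ENNReal.ofReal_pos.2 hα)).exists
  exact lt_asymm hj (hprob (φ (ψ j)))

/-! ### Countable unions of affine subspaces -/

/-- Pulled back to `S`, the set is a proper affine subspace, hence null for Haar measure. -/
theorem lebesgueOn_affineSubspace_eq_zero (S : Submodule ℝ (EuclideanSpace ℝ (Fin n)))
    (P : AffineSubspace ℝ (EuclideanSpace ℝ (Fin n)))
    (h : ¬ (S : Set (EuclideanSpace ℝ (Fin n))) ⊆ P) : lebesgueOn S P = 0 := by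
  rw [lebesgueOn, Measure.map_apply measurable_subtype_coe
    P.closed_of_finiteDimensional.measurableSet]
  refine Measure.addHaar_affineSubspace _ (P.comap S.subtype.toAffineMap) fun htop => h ?_
  intro x hx
  have : (⟨x, hx⟩ : S) ∈ P.comap S.subtype.toAffineMap := by rw [htop]; trivial
  exact this

theorem lebesgueOn_eq_zero_iff_not_subset {A : Set (EuclideanSpace ℝ (Fin n))}
    (hA : IsCountableUnionOfAffine A) (S : Submodule ℝ (EuclideanSpace ℝ (Fin n))) :
    lebesgueOn S A = 0 ↔ ¬ (S : Set (EuclideanSpace ℝ (Fin n))) ⊆ A := by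
  obtain ⟨𝒜, hc, rfl⟩ := hA
  have hmeas : MeasurableSet (⋃ P ∈ 𝒜, (P : Set (EuclideanSpace ℝ (Fin n)))) :=
    MeasurableSet.biUnion hc fun P _ => P.closed_of_finiteDimensional.measurableSet
  constructor
  · intro h0 hsub
    have h1 := (lebesgueOn_eq_zero_iff S hmeas).1 h0
    obtain ⟨x, hx⟩ := h1.exists
    exact hx (hsub x.2)
  · intro h
    refine (measure_biUnion_null_iff hc).2 fun P hP =>
      lebesgueOn_affineSubspace_eq_zero S P fun hsub => h ?_
    exact hsub.trans (subset_biUnion_of_mem (u := fun P : AffineSubspace ℝ _ =>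
      (P : Set (EuclideanSpace ℝ (Fin n)))) hP)

/-- Testing weak convergence against the constant one shows that the limit is not zero, so its
support is nonempty; symmetry moves a support point into `[0, π]`. -/
theorem nonempty_of_mem_limitSupports {L : Submodule ℝ (EuclideanSpace ℝ (Fin n))} (hL : L ≠ ⊤)
    {F : Set (ℝ → ℝ)} (hF : ∀ f ∈ F, IsNormalizedSpectralDensity f) {Γ : Set ℝ}
    (hΓ : Γ ∈ limitSupports F L) : Γ.Nonempty := by
  obtain ⟨m, hm, rfl⟩ := hΓ
  have hfinite := hm.finite
  obtain ⟨f, hf, hlim⟩ := hm.weak_limit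
  have hm0 : m ≠ 0 := by
    rintro rfl
    have h1 := hlim (BoundedContinuousFunction.const ℝ 1)
    have h2 : ∀ j, ∫ ν, (BoundedContinuousFunction.const ℝ (1 : ℝ)) ν
        ∂spectralMeasure (normalizedFilteredDensity L (f j)) = 1 := fun j => by
      have := isProbabilityMeasure_spectralMeasure
        (integrableOn_normalizedFilteredDensity (L := L) (hF _ (hf j)))
        (fun ν hν => normalizedFilteredDensity_nonneg (hF _ (hf j)) hν)
        (integral_normalizedFilteredDensity hL (hF _ (hf j)))
      simp
    simp only [h2, integral_zero_measure] at h1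
    exact one_ne_zero (tendsto_nhds_unique tendsto_const_nhds h1)
  obtain ⟨γ, hγ⟩ := Measure.nonempty_support hm0
  have hI := support_subset_Icc hm.concentrated hγ
  rcases le_total 0 γ with h0 | h0
  · exact ⟨γ, hγ, h0, hI.2⟩
  · exact ⟨-γ, neg_mem_support hm.symmetric hγ, by linarith, by linarith [hI.1]⟩

theorem not_jointSpan_subset {L : Submodule ℝ (EuclideanSpace ℝ (Fin n))} (hL : L ≠ ⊤)
    {F : Set (ℝ → ℝ)} (hF : ∀ f ∈ F, IsNormalizedSpectralDensity f)
    {A : Set (EuclideanSpace ℝ (Fin n))}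
    (h : ∀ γ ∈ ⋃₀ limitSupports F L,
      ¬ (trigSpan n (rho γ L) γ : Set (EuclideanSpace ℝ (Fin n))) ⊆ A) {Γ : Set ℝ}
    (hΓ : Γ ∈ limitSupports F L) :
    ¬ (jointSpan L Γ : Set (EuclideanSpace ℝ (Fin n))) ⊆ A := by
  obtain ⟨γ, hγ⟩ := nonempty_of_mem_limitSupports hL hF hΓ
  refine fun hsub => h γ ⟨Γ, hΓ, hγ⟩ (Subset.trans ?_ hsub)
  exact le_iSup₂_of_le (f := fun γ _ => trigSpan n (rho γ L) γ) γ hγ le_rfl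

end CriticalValues

end SizeControl

theorem mainTheorem6 {n k q : ℕ} (hk : 1 ≤ k) (hkn : k < n) (hq : 1 ≤ q)
    (X : Matrix (Fin n) (Fin k) ℝ) (hX : X.rank = k)
    (R : Matrix (Fin q) (Fin k) ℝ) (hR : R.rank = q) (r : Fin q → ℝ)
    (F : Set (ℝ → ℝ)) (hFne : F.Nonempty) (hF : ∀ f ∈ F, IsNormalizedSpectralDensity f)
    (N : Set (EuclideanSpace ℝ (Fin n)))
    (βc : EuclideanSpace ℝ (Fin n) → Fin k → ℝ)
    (Ωc : EuclideanSpace ℝ (Fin n) → Matrix (Fin q) (Fin q) ℝ)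
    (hest : EstimatorAssumption X N βc Ωc) :
    ((∀ Γ ∈ limitSupports F (nullMeansLin X R),
        lebesgueOn (jointSpan (nullMeansLin X R) Γ) (nStar N Ωc) = 0) →
      ∀ α : ℝ, 0 < α → α < 1 →
        ∃ C : ℝ, testSize X R r F {y | C ≤ fTypeStat R r N βc Ωc y} ≤ ENNReal.ofReal α) ∧
    (IsCountableUnionOfAffine (nStar N Ωc) →
      (∀ Γ ∈ limitSupports F (nullMeansLin X R),
        (lebesgueOn (jointSpan (nullMeansLin X R) Γ) (nStar N Ωc) = 0 ↔
          ¬ (jointSpan (nullMeansLin X R) Γ : Set (EuclideanSpace ℝ (Fin n))) ⊆ nStar N Ωc)) ∧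
      ((∀ γ ∈ ⋃₀ limitSupports F (nullMeansLin X R),
          ¬ (trigSpan n (rho γ (nullMeansLin X R)) γ : Set (EuclideanSpace ℝ (Fin n))) ⊆
            nStar N Ωc) →
        ∀ Γ ∈ limitSupports F (nullMeansLin X R),
          ¬ (jointSpan (nullMeansLin X R) Γ : Set (EuclideanSpace ℝ (Fin n))) ⊆ nStar N Ωc) ∧
      ((∀ γ ∈ Set.Icc 0 Real.pi,
          ¬ (trigSpan n (rho γ (nullMeansLin X R)) γ : Set (EuclideanSpace ℝ (Fin n))) ⊆
            nStar N Ωc) →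
        (∀ γ ∈ ⋃₀ limitSupports F (nullMeansLin X R),
          ¬ (trigSpan n (rho γ (nullMeansLin X R)) γ : Set (EuclideanSpace ℝ (Fin n))) ⊆
            nStar N Ωc) ∧
        ∀ Γ ∈ limitSupports F (nullMeansLin X R),
          ¬ (jointSpan (nullMeansLin X R) Γ : Set (EuclideanSpace ℝ (Fin n))) ⊆ nStar N Ωc)) := by
  have hL := nullMeansLin_ne_top hkn X R
  refine ⟨fun hnull α hα _ => hest.exists_critical_value hkn R r hF hnull hα, fun hA =>
    ⟨fun Γ _ => lebesgueOn_eq_zero_iff_not_subset hA _, fun h Γ hΓ =>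
      not_jointSpan_subset hL hF h hΓ, fun h => ?_⟩⟩
  have h1 : ∀ γ ∈ ⋃₀ limitSupports F (nullMeansLin X R),
      ¬ (trigSpan n (rho γ (nullMeansLin X R)) γ : Set (EuclideanSpace ℝ (Fin n))) ⊆
        nStar N Ωc := by
    rintro γ ⟨_, ⟨m, _, rfl⟩, hγ⟩
    exact h γ hγ.2
  exact ⟨h1, fun Γ hΓ => not_jointSpan_subset hL hF h1 hΓ⟩
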